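/- All graphs are finite and simple. Let $\mathcal{B}$ be the class of all cubic, $3$-connected, planar, bipartite graphs. For a graph $G$ and $X\subseteq V(G)$, the cut $\partial_G(X)$ is the set of edges of $G$ with exactly one endpoint in $X$; $X$ and $V(G)\setminus X$ are its shores. A cut is non-trivial if both shores have at least two vertices, and tight if it contains exactly one edge of every perfect matching of $G$. Two cuts are laminar if a shore of one of them is contained in a shore of the other. Let $G\in\mathcal{B}$ have colour classes $A,B$, and let $uv,xy\in E(G)$ with $u,y\in A$ and $v,x\in B$, such that $uv$ and $xy$ lie on a common facial cycle $C$ (of some plane embedding of $G$) and $(C-uv)-xy$ consists of two disjoint paths, each with an odd number of edges. The $C_4$-expansion of $G$ at $uv$ and $xy$ is the graph $H$ with vertex set $V(G)\cup\{u',v',x',y'\}$, where $u',v',x',y'$ are four new vertices, and edge set \[ E(H)=(E(G)\setminus\{uv,xy\})\cup\{uu',vv',xx',yy',u'v',x'y',u'x',v'y'\}. \] Let $\mathcal{F}$ be an inclusion-wise maximal family of non-trivial, pairwise laminar tight cuts in $G$, and let \[ \mathcal{F}'=\{\partial_G(X) : \partial_G(X)\in\mathcal{F},\ |\{u,v,x,y\}\cap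 X|\neq 2\}. \] Then, up to renaming the four edges $uu',vv',xx',yy'$ of $H$, $\mathcal{F}'$ is an inclusion-wise maximal family of non-trivial, pairwise laminar tight cuts in $H$. More precisely: 1. the family $\mathcal{F}_H=\{\partial_H(X) : X\subseteq V(G),\ \partial_G(X)\in\mathcal{F},\ |\{u,v,x,y\}\cap X|\le 1\}$ is an inclusion-wise maximal family of non-trivial, pairwise laminar tight cuts in $H$; 2. if $\rho$ is the renaming with $\rho(uu')=\rho(vv')=uv$, $\rho(xx')=\rho(yy')=xy$ and $\rho(e)=e$ for every other edge $e$, then $\rho$ is injective on every cut in $\mathcal{F}_H$, and $D\mapsto\rho(D)$ is a bijection from $\mathcal{F}_H$ onto $\mathcal{F}'$. -/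

import Mathlib

namespace Barnette

open SimpleGraph

/-- The Euclidean plane. -/
abbrev Plane : Type := EuclideanSpace ℝ (Fin 2)

/-- `S` is an arc in the plane with end points `p` and `q`: the image of an injective
continuous map from the unit interval that sends `0` to `p` and `1` to `q`. -/
def IsArc (p q : Plane) (S : Set Plane) : Prop :=
  ∃ γ : unitInterval → Plane,
    Continuous γ ∧ Function.Injective γ ∧ γ 0 = p ∧ γ 1 = q ∧ Set.range γ = S

/-- A drawing of the graph `G` in the plane without crossings: vertices are distinct points,
every edge is an arc between its end vertices that contains no other vertex, and two different
edges meet at most in common end vertices. -/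
structure PlaneEmbedding {V : Type*} (G : SimpleGraph V) where
  point : V → Plane
  arc : G.edgeSet → Set Plane
  point_injective : Function.Injective point
  isArc : ∀ (a b : V) (h : G.Adj a b), IsArc (point a) (point b) (arc ⟨s(a, b), h⟩)
  mem_of_point_mem_arc : ∀ (e : G.edgeSet) (w : V), point w ∈ arc e → w ∈ (e : Sym2 V)
  arc_inter_arc : ∀ e f : G.edgeSet, e ≠ f →
    arc e ∩ arc f ⊆ point '' {w | w ∈ (e : Sym2 V) ∧ w ∈ (f : Sym2 V)}

/-- The point set of the drawing: all vertices and all edges. -/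
def PlaneEmbedding.carrier {V : Type*} {G : SimpleGraph V} (D : PlaneEmbedding G) : Set Plane :=
  Set.range D.point ∪ ⋃ e, D.arc e

/-- The faces of the drawing: the connected components of the complement of its point set. -/
def PlaneEmbedding.IsFace {V : Type*} {G : SimpleGraph V} (D : PlaneEmbedding G)
    (F : Set Plane) : Prop :=
  ∃ p ∈ D.carrierᶜ, F = connectedComponentIn D.carrierᶜ p

/-- The cycle `c` of `G` is a facial cycle of the drawing: it is the boundary of a face. -/
def PlaneEmbedding.IsFacialCycle {V : Type*} {G : SimpleGraph V} (D : PlaneEmbedding G)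
    {w : V} (c : G.Walk w w) : Prop :=
  c.IsCycle ∧ ∃ F, D.IsFace F ∧ frontier F = ⋃ e ∈ {e : G.edgeSet | (e : Sym2 V) ∈ c.edges}, D.arc e

/-- `G` is planar. -/
def IsPlanar {V : Type*} (G : SimpleGraph V) : Prop :=
  Nonempty (PlaneEmbedding G)

/-- `G` is `k`-connected: it stays connected after deleting any set of at most `k - 1`
vertices. -/
def IsKConnected {V : Type*} (k : ℕ) (G : SimpleGraph V) : Prop :=
  ∀ S : Finset V, S.card < k → (G.induce ((S : Set V)ᶜ)).Connected

open Classical in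
/-- The class of all (finite, simple) cubic, 3-connected, planar, bipartite graphs. -/
structure IsBarnetteGraph {V : Type*} [Fintype V] (G : SimpleGraph V) : Prop where
  cubic : G.IsRegularOfDegree 3
  threeConnected : IsKConnected 3 G
  planar : IsPlanar G
  bipartite : G.IsBipartite

/-- `A` and `B` are the two colour classes of a bipartition of `G`. -/
def IsBipartition {V : Type*} (G : SimpleGraph V) (A B : Set V) : Prop :=
  G.IsBipartiteWith A B ∧ A ∪ B = Set.univ

/-- The cut around `X`: all edges with exactly one end point in `X`. -/
def cut {V : Type*} (G : SimpleGraph V) (X : Set V) : Set (Sym2 V) :=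
  {e | e ∈ G.edgeSet ∧ ∃ a ∈ X, ∃ b ∉ X, e = s(a, b)}

/-- `C` is a tight cut of `G`: a cut that contains exactly one edge of every perfect matching. -/
def IsTightCut {V : Type*} (G : SimpleGraph V) (C : Set (Sym2 V)) : Prop :=
  (∃ X : Set V, C = cut G X) ∧
    ∀ M : G.Subgraph, M.IsPerfectMatching → (C ∩ M.edgeSet).ncard = 1

/-- `C` is a non-trivial cut: both of its shores have at least two vertices. -/
def IsNontrivialCut {V : Type*} (G : SimpleGraph V) (C : Set (Sym2 V)) : Prop :=
  ∃ X : Set V, C = cut G X ∧ X.Nontrivial ∧ Xᶜ.Nontrivial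

/-- Two cuts are laminar if some shore of one of them is contained in a shore of the other.
(If `X ⊆ Y` then `Yᶜ ⊆ Xᶜ`, so that the relation is symmetric in the two cuts.) -/
def AreLaminar {V : Type*} (G : SimpleGraph V) (C D : Set (Sym2 V)) : Prop :=
  ∃ X Y : Set V, C = cut G X ∧ D = cut G Y ∧ (X ⊆ Y ∨ Y ⊆ X)

/-- `𝓕` is a family of non-trivial, pairwise laminar tight cuts of `G`. -/
def IsLaminarTightFamily {V : Type*} (G : SimpleGraph V) (𝓕 : Set (Set (Sym2 V))) : Prop :=
  (∀ C ∈ 𝓕, IsTightCut G C ∧ IsNontrivialCut G C) ∧ 𝓕.Pairwise (AreLaminar G)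

/-- `𝓕` is an inclusion-wise maximal family of non-trivial, pairwise laminar tight cuts. -/
def IsMaximalLaminarTightFamily {V : Type*} (G : SimpleGraph V)
    (𝓕 : Set (Set (Sym2 V))) : Prop :=
  Maximal (IsLaminarTightFamily G) 𝓕

/-- `(C - uv) - xy` consists of two odd paths, that is, it is the disjoint union of two paths
each of which has an odd number of edges. -/
def SplitsIntoOddPaths {V : Type*} {G : SimpleGraph V} {w : V} (c : G.Walk w w)
    (u v x y : V) : Prop :=
  ∃ (a b : V) (P : G.Walk a b) (a' b' : V) (Q : G.Walk a' b'),
    P.IsPath ∧ Q.IsPath ∧ Odd P.length ∧ Odd Q.length ∧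
    Disjoint P.toSubgraph.verts Q.toSubgraph.verts ∧
    (c.toSubgraph.deleteEdges {s(u, v)}).deleteEdges {s(x, y)} = P.toSubgraph ⊔ Q.toSubgraph

/-- `H` is a `C₄`-expansion, at the edges `uv` and `xy`, of the bipartite graph `G` with colour
classes `A` and `B`. The vertex set of `G` is identified with a subset of that of `H` by means
of `ι`, and `u', v', x', y'` are the four new vertices of `H`. -/
structure IsC4Expansion {V W : Type*} (G : SimpleGraph V) (A B : Set V) (H : SimpleGraph W)
    (ι : V ↪ W) (u v x y : V) (u' v' x' y' : W) : Prop where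
  adj_uv : G.Adj u v
  adj_xy : G.Adj x y
  u_mem : u ∈ A
  y_mem : y ∈ A
  v_mem : v ∈ B
  x_mem : x ∈ B
  common_face : ∃ (D : PlaneEmbedding G) (w : V) (c : G.Walk w w), D.IsFacialCycle c ∧
    s(u, v) ∈ c.edges ∧ s(x, y) ∈ c.edges ∧ SplitsIntoOddPaths c u v x y
  new_distinct : [u', v', x', y'].Nodup
  new_notMem : ∀ z ∈ [u', v', x', y'], z ∉ Set.range ι
  verts : (ι '' A ∪ {v', x'}) ∪ (ι '' B ∪ {u', y'}) = Set.univ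
  edges : H.edgeSet = Sym2.map ι '' (G.edgeSet \ {s(u, v), s(x, y)}) ∪
    {s(ι u, u'), s(ι v, v'), s(ι x, x'), s(ι y, y'),
      s(u', v'), s(x', y'), s(u', x'), s(v', y')}

/-- The cuts of `𝓕` of the form `∂(X)` with `|{u, v, x, y} ∩ X| ≠ 2`. -/
def survivingCuts {V : Type*} (G : SimpleGraph V) (𝓕 : Set (Set (Sym2 V))) (u v x y : V) :
    Set (Set (Sym2 V)) :=
  {C | C ∈ 𝓕 ∧ ∃ X : Set V, C = cut G X ∧ (({u, v, x, y} : Set V) ∩ X).ncard ≠ 2}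

/-- The cuts of `𝓕` of the form `∂_G(X)` with `|{u, v, x, y} ∩ X| ≠ 2`, read in the expansion:
the shore `X` with `|{u, v, x, y} ∩ X| ≤ 1` is kept, and the four new vertices
lie on the other side. -/
def expandedCuts {V W : Type*} (G : SimpleGraph V) (H : SimpleGraph W) (ι : V ↪ W)
    (𝓕 : Set (Set (Sym2 V))) (u v x y : V) : Set (Set (Sym2 W)) :=
  {D | ∃ X : Set V, cut G X ∈ 𝓕 ∧ (({u, v, x, y} : Set V) ∩ X).ncard ≤ 1 ∧ D = cut H (ι '' X)}

open Classical in
/-- The renaming of the four edges `uu'`, `vv'`, `xx'`, `yy'` of the expansion: the first two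
get the name `uv` and the last two the name `xy`; every other edge keeps its name. -/
noncomputable def renameEdge {V W : Type*} (ι : V ↪ W) (u v x y : V) (u' v' x' y' : W)
    (e : Sym2 W) : Sym2 W :=
  if e = s(ι u, u') ∨ e = s(ι v, v') then s(ι u, ι v)
  else if e = s(ι x, x') ∨ e = s(ι y, y') then s(ι x, ι y)
  else e

end Barnette

namespace Barnette

open SimpleGraph

/-! In a cubic bipartite graph a cut is tight exactly when it has three edges
(`isTightCut_cut_iff`). One direction splits the graph into perfect matchings; the other is a degree
count on the colour classes of a shore, which also shows that all edges of a 3-edge cut leave the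
shore from the same class. In a 3-edge-connected graph 3-edge cuts never cross
(`three_cuts_nested`), so the maximal family `𝓕` is the set of all non-trivial 3-edge cuts of `G`.

It remains to see that the non-trivial 3-edge cuts of `H` are those of `G` whose shore `X` contains
at most one of `u, v, x, y` (`mem_expandedCuts_iff`). For such `X` the renaming matches the two cuts
edge by edge. Conversely, the colour argument and the new 4-cycle force the four new vertices onto
one side of a non-trivial 3-edge cut of `H` (`subset_range_or_compl_subset_range`). The other shore
then contains members of only one of the pairs `u, y` and `v, x`. It cannot contain a whole pair: a
cut of `G` separating the two pairs contains `uv`, `xy` and an edge of each of the two odd paths,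
hence four edges (`SplitsIntoOddPaths.nodup_and_four_le`), while passing from `G` to `H` never
shrinks a cut around old vertices (`ncard_cut_le`). -/

/-- The number of ordered pairs of adjacent vertices in `X × Y`. -/
noncomputable def adjCount {V : Type*} (G : SimpleGraph V) (X Y : Set V) : ℕ :=
  {p : V × V | p.1 ∈ X ∧ p.2 ∈ Y ∧ G.Adj p.1 p.2}.ncard

/-! ### Edge counts between vertex sets, and uncrossing of 3-edge cuts. -/

section Counting

variable {V : Type*} {G : SimpleGraph V}

lemma adjCount_comm (X Y : Set V) : adjCount G X Y = adjCount G Y X := by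
  unfold adjCount
  rw [← Set.ncard_image_of_injective _ Prod.swap_injective]
  congr 1
  ext ⟨a, b⟩
  simp only [Set.mem_image, Set.mem_ofPred_eq, Prod.exists, Prod.swap_prod_mk, Prod.mk.injEq]
  constructor
  · rintro ⟨c, d, ⟨h1, h2, h3⟩, rfl, rfl⟩
    exact ⟨h2, h1, h3.symm⟩
  · rintro ⟨h1, h2, h3⟩
    exact ⟨b, a, ⟨h2, h1, h3.symm⟩, rfl, rfl⟩

lemma adjCount_union_left [Finite V] {X X' : Set V} (h : Disjoint X X') (Y : Set V) :
    adjCount G (X ∪ X') Y = adjCount G X Y + adjCount G X' Y := by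
  unfold adjCount
  rw [← Set.ncard_union_eq]
  · congr 1
    ext p
    simp only [Set.mem_ofPred_eq, Set.mem_union]
    tauto
  · rw [Set.disjoint_left] at h ⊢
    exact fun p hp hp' => h hp.1 hp'.1

lemma adjCount_union_right [Finite V] (X : Set V) {Y Y' : Set V} (h : Disjoint Y Y') :
    adjCount G X (Y ∪ Y') = adjCount G X Y + adjCount G X Y' := by
  rw [adjCount_comm, adjCount_union_left h, adjCount_comm Y, adjCount_comm Y']

lemma adjCount_mono [Finite V] {X X' Y Y' : Set V} (hX : X ⊆ X') (hY : Y ⊆ Y') :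
    adjCount G X Y ≤ adjCount G X' Y' :=
  Set.ncard_le_ncard (fun _ hp => ⟨hX hp.1, hY hp.2.1, hp.2.2⟩) (Set.toFinite _)

lemma adjCount_mono_graph [Finite V] {K : SimpleGraph V} (h : K ≤ G) (X Y : Set V) :
    adjCount K X Y ≤ adjCount G X Y :=
  Set.ncard_le_ncard (fun _ hp => ⟨hp.1, hp.2.1, h hp.2.2⟩) (Set.toFinite _)

lemma adjCount_eq_zero_iff [Finite V] {X Y : Set V} :
    adjCount G X Y = 0 ↔ ∀ a ∈ X, ∀ b ∈ Y, ¬ G.Adj a b := by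
  unfold adjCount
  rw [Set.ncard_eq_zero (Set.toFinite _), Set.eq_empty_iff_forall_notMem]
  simp only [Set.mem_ofPred_eq, Prod.forall]
  exact ⟨fun h a ha b hb hab => h a b ⟨ha, hb, hab⟩, fun h a b ⟨ha, hb, hab⟩ => h a ha b hb hab⟩

lemma adjCount_singleton_left (a : V) (Y : Set V) :
    adjCount G {a} Y = (G.neighborSet a ∩ Y).ncard := by
  unfold adjCount
  rw [← Set.ncard_image_of_injective (G.neighborSet a ∩ Y) (Prod.mk_right_injective a)]
  congr 1
  ext ⟨c, d⟩
  simp only [Set.mem_ofPred_eq, Set.mem_singleton_iff, Set.mem_image, Set.mem_inter_iff,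
    mem_neighborSet, Prod.mk.injEq]
  constructor
  · rintro ⟨rfl, h, h'⟩
    exact ⟨d, ⟨h', h⟩, rfl, rfl⟩
  · rintro ⟨_, ⟨h', h⟩, rfl, rfl⟩
    exact ⟨rfl, h, h'⟩

lemma adjCount_univ_right [Finite V] {k : ℕ} (hk : ∀ a, (G.neighborSet a).ncard = k) (X : Set V) :
    adjCount G X Set.univ = k * X.ncard := by
  induction X, Set.toFinite X using Set.Finite.induction_on with
  | empty => simp [adjCount]
  | @insert a S ha hS ih =>
    rw [Set.insert_eq, adjCount_union_left (by simpa using ha), ih, adjCount_singleton_left,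
      Set.inter_univ, hk, ← Set.insert_eq, Set.ncard_insert_of_notMem ha]
    ring

lemma adjCount_self_le [Finite V] (X : Set V) :
    adjCount G X X + X.ncard ≤ X.ncard * X.ncard := by
  rw [← Set.ncard_prod]
  have h : X.ncard = ((fun a => (a, a)) '' X : Set (V × V)).ncard :=
    (Set.ncard_image_of_injective _ fun a b h => (Prod.mk.inj h).1).symm
  rw [h]
  unfold adjCount
  rw [← Set.ncard_union_eq]
  · apply Set.ncard_le_ncard _ (Set.toFinite _)
    rintro p (hp | ⟨a, ha, rfl⟩)
    · exact ⟨hp.1, hp.2.1⟩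
    · exact ⟨ha, ha⟩
  · rw [Set.disjoint_left]
    rintro _ hp ⟨a, _, rfl⟩
    exact hp.2.2.ne rfl

lemma mk_mem_cut_iff {X : Set V} {a b : V} :
    s(a, b) ∈ cut G X ↔ G.Adj a b ∧ (a ∈ X ↔ b ∉ X) := by
  unfold cut
  simp only [Set.mem_ofPred_eq, mem_edgeSet]
  refine and_congr_right fun _ => ⟨?_, fun h => ?_⟩
  · rintro ⟨c, hc, d, hd, h⟩
    rcases Sym2.eq_iff.1 h with ⟨rfl, rfl⟩ | ⟨rfl, rfl⟩ <;> tauto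
  · by_cases ha : a ∈ X
    · exact ⟨a, ha, b, h.1 ha, rfl⟩
    · exact ⟨b, by tauto, a, ha, Sym2.eq_swap⟩

lemma cut_compl (X : Set V) : cut G Xᶜ = cut G X := by
  ext e
  induction e with
  | _ a b =>
    simp only [mk_mem_cut_iff, Set.mem_compl_iff]
    tauto

lemma ncard_cut (X : Set V) : (cut G X).ncard = adjCount G X Xᶜ := by
  unfold adjCount
  rw [← Set.InjOn.ncard_image (f := fun p : V × V => s(p.1, p.2))]
  · congr 1
    ext e
    constructor
    · rintro ⟨he, a, ha, b, hb, rfl⟩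
      exact ⟨(a, b), ⟨ha, hb, he⟩, rfl⟩
    · rintro ⟨⟨a, b⟩, ⟨ha, hb, h⟩, rfl⟩
      exact ⟨h, a, ha, b, hb, rfl⟩
  · rintro ⟨a, b⟩ ⟨ha, hb, h⟩ ⟨c, d⟩ ⟨hc, hd, h'⟩ heq
    rcases Sym2.eq_iff.1 heq with ⟨h1, h2⟩ | ⟨h1, h2⟩
    · exact Prod.ext h1 h2
    · simp only at h1 ha hd
      exact absurd (h1 ▸ ha) hd

/-- Degree count on the two colour classes of a shore. -/
lemma mul_ncard_inter_add [Finite V] {A B : Set V} (hAB : IsBipartition G A B) {k : ℕ}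
    (hk : ∀ a, (G.neighborSet a).ncard = k) (X : Set V) :
    k * (X ∩ A).ncard + adjCount G (X ∩ B) Xᶜ = k * (X ∩ B).ncard + adjCount G (X ∩ A) Xᶜ := by
  have key : ∀ {A B : Set V}, IsBipartition G A B →
      k * (X ∩ A).ncard = adjCount G (X ∩ A) (X ∩ B) + adjCount G (X ∩ A) Xᶜ := by
    intro A B h
    rw [← adjCount_univ_right hk, ← Set.union_compl_self X, adjCount_union_right _ disjoint_compl_right]
    congr 1
    unfold adjCount
    congr 1
    ext ⟨a, b⟩
    simp only [Set.mem_ofPred_eq, Set.mem_inter_iff]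
    refine ⟨fun ⟨ha, hb, hab⟩ => ⟨ha, ⟨hb, ?_⟩, hab⟩, fun ⟨ha, hb, hab⟩ => ⟨ha, hb.1, hab⟩⟩
    rcases h.1.mem_of_adj hab with h' | h'
    · exact h'.2
    · exact absurd ha.2 (Set.disjoint_right.1 h.1.disjoint h'.1)
  -- In the counts for the two classes, the edges between `X ∩ A` and `X ∩ B` occur in both and
  -- cancel.
  have hBA : IsBipartition G B A := ⟨hAB.1.symm, by rw [Set.union_comm]; exact hAB.2⟩
  have h1 := key hAB
  have h2 := key hBA
  rw [adjCount_comm] at h2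
  omega

lemma adjCount_eq_inter_add_inter [Finite V] {A B : Set V} (hAB : IsBipartition G A B)
    (X Y : Set V) : adjCount G X Y = adjCount G (X ∩ A) Y + adjCount G (X ∩ B) Y := by
  rw [← adjCount_union_left (hAB.1.disjoint.mono Set.inter_subset_right Set.inter_subset_right),
    ← Set.inter_union_distrib_left, hAB.2, Set.inter_univ]

/-- All edges of a 3-edge cut of a cubic bipartite graph leave a shore from the same colour
class, which has a surplus of one vertex there. -/
lemma three_cut_sides [Finite V] {A B : Set V} (hAB : IsBipartition G A B)
    (hk : ∀ a, (G.neighborSet a).ncard = 3) {X : Set V} (hX : (cut G X).ncard = 3) :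
    (adjCount G (X ∩ B) Xᶜ = 0 ∧ (X ∩ A).ncard = (X ∩ B).ncard + 1) ∨
      (adjCount G (X ∩ A) Xᶜ = 0 ∧ (X ∩ B).ncard = (X ∩ A).ncard + 1) := by
  rw [ncard_cut, adjCount_eq_inter_add_inter hAB] at hX
  -- The numbers of edges leaving from the two classes are congruent modulo 3 and add up to 3, so
  -- one of them is 0.
  have := mul_ncard_inter_add hAB hk X
  omega

/-- In a graph all of whose cuts have at least three edges, 3-edge cuts do not cross. -/
lemma three_cuts_nested [Finite V]
    (h3 : ∀ X : Set V, X.Nonempty → Xᶜ.Nonempty → 3 ≤ (cut G X).ncard) {X Y : Set V}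
    (hX : (cut G X).ncard = 3) (hY : (cut G Y).ncard = 3) :
    X ⊆ Y ∨ Y ⊆ X ∨ X ⊆ Yᶜ ∨ Yᶜ ⊆ X := by
  by_contra! hcon
  obtain ⟨h1, h2, h4, h5⟩ := hcon
  obtain ⟨b, hbX, hbY⟩ := Set.not_subset.1 h1
  obtain ⟨c, hcY, hcX⟩ := Set.not_subset.1 h2
  obtain ⟨a, haX, haY⟩ := Set.not_subset.1 h4
  obtain ⟨e, heY, heX⟩ := Set.not_subset.1 h5
  have haY : a ∈ Y := not_not.1 haY
  set P := X ∩ Y with hP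
  set Q := X \ Y with hQ
  set R := Y \ X with hR
  set S := (X ∪ Y)ᶜ with hS
  have hPQ : Disjoint P Q := Set.disjoint_left.2 fun z hz hz' => hz'.2 hz.2
  have hPR : Disjoint P R := Set.disjoint_left.2 fun z hz hz' => hz'.2 hz.1
  have hQR : Disjoint Q R := Set.disjoint_left.2 fun z hz hz' => hz'.2 hz.1
  have hPS : Disjoint P S := Set.disjoint_left.2 fun z hz hz' => hz' (Or.inl hz.1)
  have hQS : Disjoint Q S := Set.disjoint_left.2 fun z hz hz' => hz' (Or.inl hz.1)
  have hRS : Disjoint R S := Set.disjoint_left.2 fun z hz hz' => hz' (Or.inr hz.1)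
  have eX : X = P ∪ Q := (Set.inter_union_sdiff X Y).symm
  have eX' : Xᶜ = R ∪ S := by ext z; simp [hR, hS]; tauto
  have eY : Y = P ∪ R := by ext z; simp [hP, hR]; tauto
  have eY' : Yᶜ = Q ∪ S := by ext z; simp [hQ, hS]; tauto
  have eP : Pᶜ = Q ∪ (R ∪ S) := by ext z; simp [hP, hQ, hR, hS]; tauto
  have eQ : Qᶜ = P ∪ (R ∪ S) := by ext z; simp [hP, hQ, hR, hS]; tauto
  have eR : Rᶜ = P ∪ (Q ∪ S) := by ext z; simp [hP, hQ, hR, hS]; tauto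
  have eS : Sᶜ = P ∪ (Q ∪ R) := by ext z; simp [hP, hQ, hR, hS]; tauto
  have cP := h3 P ⟨a, haX, haY⟩ ⟨b, fun h => hbY h.2⟩
  have cQ := h3 Q ⟨b, hbX, hbY⟩ ⟨a, fun h => h.2 haY⟩
  have cR := h3 R ⟨c, hcY, hcX⟩ ⟨a, fun h => h.2 haX⟩
  have cS := h3 S ⟨e, fun h => h.elim heX heY⟩ ⟨a, fun h => h (Or.inl haX)⟩
  rw [ncard_cut, eX'] at hX
  rw [ncard_cut, eY'] at hY
  rw [eX, adjCount_union_left hPQ, adjCount_union_right _ hRS, adjCount_union_right _ hRS] at hX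
  rw [eY, adjCount_union_left hPR, adjCount_union_right _ hQS, adjCount_union_right _ hQS] at hY
  rw [ncard_cut, eP, adjCount_union_right _ (Set.disjoint_union_right.2 ⟨hQR, hQS⟩),
    adjCount_union_right _ hRS] at cP
  rw [ncard_cut, eQ, adjCount_union_right _ (Set.disjoint_union_right.2 ⟨hPR, hPS⟩),
    adjCount_union_right _ hRS] at cQ
  rw [ncard_cut, eR, adjCount_union_right _ (Set.disjoint_union_right.2 ⟨hPQ, hPS⟩),
    adjCount_union_right _ hQS] at cR
  rw [ncard_cut, eS, adjCount_union_right _ (Set.disjoint_union_right.2 ⟨hPQ, hPR⟩),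
    adjCount_union_right _ hQR] at cS
  have e1 := adjCount_comm (G := G) P Q
  have e2 := adjCount_comm (G := G) P R
  have e3 := adjCount_comm (G := G) P S
  have e4 := adjCount_comm (G := G) Q R
  have e5 := adjCount_comm (G := G) Q S
  have e6 := adjCount_comm (G := G) R S
  -- Adding the cuts of opposite corners leaves no edges between `P` and `S` or between `Q` and `R`,
  -- and every corner has exactly three cut edges. Then as many edges join `P` to `R` as `Q` to `S`,
  -- but together these are the three edges of the cut around `X`: a parity contradiction.
  omega

end Counting

section TightCuts

variable {V : Type*} {G : SimpleGraph V}

/-- Hall's condition by double counting: the `k * |S|` edge ends at `S` have their other ends in the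
neighbourhood of `S`, where each vertex takes only `k`. -/
lemma exists_isPerfectMatching_of_regular [Finite V] {A B : Set V} (hAB : IsBipartition G A B)
    {k : ℕ} (hk : ∀ a, (G.neighborSet a).ncard = k) (hpos : 0 < k) :
    ∃ M : G.Subgraph, M.IsPerfectMatching := by
  classical
  have := Fintype.ofFinite V
  refine exists_isPerfectMatching_of_forall_ncard_le hAB.1 fun S => ?_
  refine Nat.le_of_mul_le_mul_left ?_ hpos
  rw [← adjCount_univ_right hk, ← adjCount_univ_right hk, adjCount_comm S]
  refine Set.ncard_le_ncard ?_ (Set.toFinite _)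
  rintro ⟨a, b⟩ ⟨-, hb, h⟩
  exact ⟨Set.mem_biUnion hb h.symm, trivial, h⟩

lemma ncard_neighborSet_spanningCoe {M : G.Subgraph} (hM : M.IsPerfectMatching) (a : V) :
    (M.spanningCoe.neighborSet a).ncard = 1 := by
  obtain ⟨b, hb, hb'⟩ := Subgraph.isPerfectMatching_iff.1 hM a
  rw [Set.ncard_eq_one]
  refine ⟨b, Set.eq_singleton_iff_unique_mem.2 ⟨hb, fun c hc => hb' c hc⟩⟩

lemma cut_spanningCoe (M : G.Subgraph) (X : Set V) :
    cut M.spanningCoe X = cut G X ∩ M.edgeSet := by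
  ext e
  induction e with
  | _ a b =>
    simp only [Set.mem_inter_iff, mk_mem_cut_iff, Subgraph.mem_edgeSet, Subgraph.spanningCoe_adj]
    exact ⟨fun h => ⟨⟨h.1.adj_sub, h.2⟩, h.1⟩, fun h => ⟨h.2, h.1.2⟩⟩

/-- In a `k`-regular bipartite graph, a cut that meets each perfect matching in one edge has
`k` edges. -/
lemma ncard_cut_of_meets_matchings_once [Finite V] {A B : Set V} (X : Set V) (k : ℕ)
    (hAB : IsBipartition G A B) (hk : ∀ a, (G.neighborSet a).ncard = k)
    (h : ∀ K ≤ G, (∀ a, (K.neighborSet a).ncard = 1) → (cut K X).ncard = 1) :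
    (cut G X).ncard = k := by
  induction k generalizing G with
  | zero =>
    rw [Set.ncard_eq_zero (Set.toFinite _), Set.eq_empty_iff_forall_notMem]
    intro e
    induction e with
    | _ a b =>
      rw [mk_mem_cut_iff]
      rintro ⟨hab, -⟩
      have := (Set.ncard_eq_zero (Set.toFinite _)).1 (hk a)
      exact Set.eq_empty_iff_forall_notMem.1 this b hab
  | succ k ih =>
    -- Removing a perfect matching leaves a `k`-regular graph whose perfect matchings are perfect
    -- matchings of `G`, and takes exactly one edge from the cut.
    obtain ⟨M, hM⟩ := exists_isPerfectMatching_of_regular hAB hk k.succ_pos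
    set K := M.spanningCoe with hK
    have hKG : K ≤ G := M.spanningCoe_le
    have hK1 : ∀ a, (K.neighborSet a).ncard = 1 := ncard_neighborSet_spanningCoe hM
    have hle : G \ K ≤ G := sdiff_le
    have h1 : (cut (G \ K) X).ncard = k := by
      refine ih ⟨⟨hAB.1.disjoint, fun a b hab => hAB.1.mem_of_adj (hle hab)⟩, hAB.2⟩ (fun a => ?_)
        fun K' hK' => h K' (hK'.trans hle)
      have : (G \ K).neighborSet a = G.neighborSet a \ K.neighborSet a := by
        ext b
        simp
      have hsub : K.neighborSet a ⊆ G.neighborSet a := fun b hb => hKG hb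
      rw [this, Set.ncard_sdiff hsub (Set.toFinite _), hk, hK1]
      rfl
    have h2 := h K hKG hK1
    have : cut G X = cut (G \ K) X ∪ cut K X := by
      ext e
      induction e with
      | _ a b =>
        simp only [Set.mem_union, mk_mem_cut_iff, sdiff_adj]
        have := @hKG a b
        tauto
    rw [this, Set.ncard_union_eq _ (Set.toFinite _) (Set.toFinite _), h1, h2]
    rw [Set.disjoint_left]
    intro e
    induction e with
    | _ a b =>
      simp only [mk_mem_cut_iff, sdiff_adj]
      tauto

/-- The graph splits into three perfect matchings, each with one edge in a tight cut. Conversely, a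
3-edge cut is left from a single class, which has a surplus of one vertex in the shore; the degree
count with `k = 1` shows that a perfect matching sends exactly this surplus across. -/
lemma isTightCut_cut_iff [Finite V] {A B : Set V} (hAB : IsBipartition G A B)
    (hk : ∀ a, (G.neighborSet a).ncard = 3) (X : Set V) :
    IsTightCut G (cut G X) ↔ (cut G X).ncard = 3 := by
  constructor
  · rintro ⟨-, h⟩
    refine ncard_cut_of_meets_matchings_once X 3 hAB hk fun K hK hK1 => ?_
    have hM : (toSubgraph K hK).IsPerfectMatching := by
      rw [Subgraph.isPerfectMatching_iff]
      intro a
      obtain ⟨b, hb⟩ := Set.ncard_eq_one.1 (hK1 a)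
      obtain ⟨hb1, hb2⟩ := Set.eq_singleton_iff_unique_mem.1 hb
      exact ⟨b, hb1, fun c hc => hb2 c hc⟩
    rw [← h _ hM, ← cut_spanningCoe]
    rfl
  · refine fun h => ⟨⟨X, rfl⟩, fun M hM => ?_⟩
    have hle : M.spanningCoe ≤ G := M.spanningCoe_le
    have hAB' : IsBipartition M.spanningCoe A B :=
      ⟨⟨hAB.1.disjoint, fun a b hab => hAB.1.mem_of_adj (hle hab)⟩, hAB.2⟩
    rw [← cut_spanningCoe, ncard_cut, adjCount_eq_inter_add_inter hAB']
    have h1 := mul_ncard_inter_add hAB' (ncard_neighborSet_spanningCoe hM) X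
    have h2 := adjCount_mono_graph hle (X ∩ A) Xᶜ
    have h3 := adjCount_mono_graph hle (X ∩ B) Xᶜ
    have := three_cut_sides hAB hk h
    omega

end TightCuts

/-! ### Edge connectivity, the shores of a cut, and uniqueness of the maximal family. -/

section Connectivity

variable {V : Type*} {G : SimpleGraph V}

lemma exists_adj_of_connected {G : SimpleGraph V} (h : G.Connected) {X : Set V} (h1 : X.Nonempty)
    (h2 : Xᶜ.Nonempty) : ∃ a ∈ X, ∃ b ∉ X, G.Adj a b := by
  obtain ⟨a, ha⟩ := h1
  obtain ⟨b, hb⟩ := h2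
  obtain ⟨p⟩ := h.preconnected a b
  obtain ⟨d, -, hd1, hd2⟩ := p.exists_boundary_dart X ha hb
  exact ⟨_, hd1, _, hd2, d.adj⟩

lemma IsKConnected.exists_adj [Finite V] {k : ℕ} (h : IsKConnected k G) {S X : Set V}
    (hS : S.ncard < k) (h1 : (X \ S).Nonempty) (h2 : (Xᶜ \ S).Nonempty) :
    ∃ a ∈ X \ S, ∃ b ∈ Xᶜ \ S, G.Adj a b := by
  have hc := h S.toFinite.toFinset (by rwa [← Set.ncard_eq_toFinset_card])
  rw [Set.Finite.coe_toFinset] at hc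
  obtain ⟨p, hp, hpS⟩ := h1
  obtain ⟨q, hq, hqS⟩ := h2
  obtain ⟨⟨a, ha⟩, haX, ⟨b, hb⟩, hbX, hab⟩ :=
    exists_adj_of_connected hc (X := {z | (z : V) ∈ X}) ⟨⟨p, hpS⟩, hp⟩ ⟨⟨q, hqS⟩, hq⟩
  exact ⟨a, ⟨haX, ha⟩, b, ⟨hbX, hb⟩, hab⟩

lemma IsKConnected.connected {k : ℕ} (hk : 0 < k) (h : IsKConnected k G) : G.Connected := by
  have := h ∅ (by simpa)
  rw [Finset.coe_empty, Set.compl_empty] at this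
  exact this.map (induceUnivIso G).toHom (induceUnivIso G).surjective

/-- A cubic 3-connected graph is 3-edge-connected. -/
lemma three_le_ncard_cut [Finite V] (hk : ∀ a, (G.neighborSet a).ncard = 3)
    (h3 : IsKConnected 3 G) {X : Set V} (h1 : X.Nonempty) (h2 : Xᶜ.Nonempty) :
    3 ≤ (cut G X).ncard := by
  rw [ncard_cut]
  by_contra! hlt
  set T : Set V := {a | a ∈ X ∧ ∃ b ∉ X, G.Adj a b} with hT
  have hTX : T ⊆ X := fun a ha => ha.1
  have hTcard : T.ncard < 3 := by
    refine lt_of_le_of_lt ?_ hlt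
    have : T = Prod.fst '' {p : V × V | p.1 ∈ X ∧ p.2 ∈ Xᶜ ∧ G.Adj p.1 p.2} := by
      ext a
      simp [hT]
    rw [this]
    exact Set.ncard_image_le (Set.toFinite _)
  -- The ends `T` of the cut edges in `X` number at most two, so they cannot separate the rest of
  -- `X` from the complement. A shore of one or two vertices, however, has at least three or four
  -- outgoing edges.
  have hXT : X = T := by
    refine Set.Subset.antisymm ?_ hTX
    by_contra hne
    obtain ⟨p, hp⟩ := Set.not_subset.1 hne
    obtain ⟨q, hq⟩ := h2
    obtain ⟨a, ha, b, hb, hab⟩ := h3.exists_adj (X := X) hTcard ⟨p, hp⟩ ⟨q, hq, fun h => hq h.1⟩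
    exact ha.2 ⟨ha.1, b, hb.1, hab⟩
  have hpos : 0 < X.ncard := (Set.ncard_pos (Set.toFinite _)).2 h1
  have e1 := adjCount_univ_right hk X
  rw [← Set.union_compl_self X, adjCount_union_right _ disjoint_compl_right] at e1
  have e2 := adjCount_self_le (G := G) X
  rw [← hXT] at hTcard
  interval_cases X.ncard <;> omega

lemma eq_empty_or_univ_of_ncard_cut_lt
    (h3 : ∀ X : Set V, X.Nonempty → Xᶜ.Nonempty → 3 ≤ (cut G X).ncard) {X : Set V}
    (hX : (cut G X).ncard < 3) : X = ∅ ∨ X = Set.univ := by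
  by_contra! h
  have := h3 X h.1 (Set.nonempty_compl.2 h.2)
  omega

/-- An edge between the vertices where `X` and `Y` agree and those where they differ would lie in
exactly one of the two cuts. -/
lemma eq_or_eq_compl_of_cut_eq (hG : G.Connected) {X Y : Set V} (h : cut G X = cut G Y) :
    X = Y ∨ X = Yᶜ := by
  by_cases h1 : {z | z ∈ X ↔ z ∈ Y}.Nonempty
  · by_cases h2 : {z | z ∈ X ↔ z ∈ Y}ᶜ.Nonempty
    · obtain ⟨a, ha, b, hb, hab⟩ := exists_adj_of_connected hG h1 h2
      have := Set.ext_iff.1 h s(a, b)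
      rw [mk_mem_cut_iff, mk_mem_cut_iff] at this
      simp only [Set.mem_ofPred_eq] at ha hb
      tauto
    · left
      ext z
      exact Set.notMem_compl_iff.1 (Set.eq_empty_iff_forall_notMem.1
        (Set.not_nonempty_iff_eq_empty.1 h2) z)
  · right
    ext z
    have := Set.eq_empty_iff_forall_notMem.1 (Set.not_nonempty_iff_eq_empty.1 h1) z
    simp only [Set.mem_ofPred_eq] at this
    rw [Set.mem_compl_iff]
    tauto

lemma isNontrivialCut_cut_iff (hG : G.Connected) (X : Set V) :
    IsNontrivialCut G (cut G X) ↔ X.Nontrivial ∧ Xᶜ.Nontrivial := by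
  refine ⟨?_, fun h => ⟨X, rfl, h.1, h.2⟩⟩
  rintro ⟨Y, hXY, h1, h2⟩
  rcases eq_or_eq_compl_of_cut_eq hG hXY with rfl | rfl
  · exact ⟨h1, h2⟩
  · exact ⟨h2, by rwa [compl_compl]⟩

/-- The only maximal laminar family of a 3-edge-connected cubic bipartite graph consists of all
its non-trivial tight cuts. -/
lemma mem_iff_of_isMaximalLaminarTightFamily [Finite V] {A B : Set V} (hAB : IsBipartition G A B)
    (hk : ∀ a, (G.neighborSet a).ncard = 3)
    (h3 : ∀ X : Set V, X.Nonempty → Xᶜ.Nonempty → 3 ≤ (cut G X).ncard)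
    {𝓕 : Set (Set (Sym2 V))} (h𝓕 : IsMaximalLaminarTightFamily G 𝓕) (C : Set (Sym2 V)) :
    C ∈ 𝓕 ↔ IsTightCut G C ∧ IsNontrivialCut G C := by
  -- All non-trivial tight cuts together already form a laminar family, so a maximal family contains
  -- every one of them.
  have key : IsLaminarTightFamily G {C | IsTightCut G C ∧ IsNontrivialCut G C} := by
    refine ⟨fun C hC => hC, ?_⟩
    rintro C ⟨hC, -⟩ D ⟨hD, -⟩ -
    obtain ⟨X, rfl⟩ := hC.1
    obtain ⟨Y, rfl⟩ := hD.1
    rw [isTightCut_cut_iff hAB hk] at hC hD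
    rcases three_cuts_nested h3 hC hD with h | h | h | h
    · exact ⟨X, Y, rfl, rfl, Or.inl h⟩
    · exact ⟨X, Y, rfl, rfl, Or.inr h⟩
    · exact ⟨X, Yᶜ, rfl, (cut_compl Y).symm, Or.inl h⟩
    · exact ⟨X, Yᶜ, rfl, (cut_compl Y).symm, Or.inr h⟩
  exact ⟨fun h => h𝓕.prop.1 C h, fun h => h𝓕.2 key (fun D hD => h𝓕.prop.1 D hD) h⟩

end Connectivity

/-! ### Cuts across a cycle that is split into two odd paths. -/

section Cycle

variable {V : Type*} {G : SimpleGraph V}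

/-- The first vertex of one of two disjoint non-trivial paths obtained from a cycle by deleting
`uv` and `xy` is an end of `uv` or `xy`. -/
lemma start_mem_of_deleteEdges_eq_sup {w : V} {c : G.Walk w w} (hc : c.IsCycle) {u v x y : V}
    {K : G.Subgraph} {a b : V} {P : G.Walk a b} (hP : P.IsPath) (hodd : Odd P.length)
    (hd : Disjoint P.toSubgraph.verts K.verts)
    (h : (c.toSubgraph.deleteEdges {s(u, v)}).deleteEdges {s(x, y)} = P.toSubgraph ⊔ K) :
    a = u ∨ a = v ∨ a = x ∨ a = y := by
  by_contra! hcon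
  obtain ⟨hu, hv, hx, hy⟩ := hcon
  have haP : a ∈ P.toSubgraph.verts := P.start_mem_verts_toSubgraph
  have hac : a ∈ c.support := by
    rw [← Walk.mem_verts_toSubgraph]
    have : a ∈ ((c.toSubgraph.deleteEdges {s(u, v)}).deleteEdges {s(x, y)}).verts := by
      rw [h]
      exact Or.inl haP
    simpa using this
  have h2 := hc.ncard_neighborSet_toSubgraph_eq_two hac
  have hnil : ¬ P.Nil := by
    rw [Walk.not_nil_iff_lt_length]
    exact hodd.pos
  have h1 := hP.neighborSet_toSubgraph_startpoint hnil
  -- Away from the deleted edges `a` keeps its two neighbours on the cycle, but the first vertex of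
  -- a non-trivial path has only one.
  have : c.toSubgraph.neighborSet a = P.toSubgraph.neighborSet a := by
    ext z
    rw [Subgraph.mem_neighborSet, Subgraph.mem_neighborSet]
    have hz : ((c.toSubgraph.deleteEdges {s(u, v)}).deleteEdges {s(x, y)}).Adj a z ↔
        (P.toSubgraph ⊔ K).Adj a z := by rw [h]
    simp only [Subgraph.deleteEdges_adj, Subgraph.sup_adj, Set.mem_singleton_iff, Sym2.eq_iff]
      at hz
    have hK : ¬ K.Adj a z := fun h => Set.disjoint_left.1 hd haP h.fst_mem
    tauto
  rw [this, h1, Set.ncard_singleton] at h2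
  omega

lemma end_mem_iff_of_odd {A B : Set V} (hAB : IsBipartition G A B) {a b : V} (P : G.Walk a b)
    (hP : Odd P.length) : a ∈ A ↔ b ∉ A := by
  have key : ∀ {a b : V} (P : G.Walk a b), ((a ∈ A ↔ b ∈ A) ↔ Even P.length) := by
    intro a b P
    induction P with
    | nil => simp
    | @cons a c b hac P ih =>
      have : a ∈ A ↔ c ∉ A := by
        have hd := hAB.1.disjoint
        rw [Set.disjoint_left] at hd
        have h1 := @hd a
        have h2 := @hd c
        have := hAB.1.mem_of_adj hac
        tauto
      rw [Walk.length_cons, Nat.even_add_one]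
      tauto
  have := key P
  rw [← Nat.not_even_iff_odd] at hP
  tauto

/-- A path whose ends lie on different sides of `X` contains an edge of the cut around `X`. -/
lemma exists_mem_edges_mem_cut {X : Set V} {a b : V} (P : G.Walk a b) (h : a ∈ X ↔ b ∉ X) :
    ∃ e ∈ P.edges, e ∈ cut G X := by
  by_cases ha : a ∈ X
  · obtain ⟨d, hd, h1, h2⟩ := P.exists_boundary_dart X ha (h.1 ha)
    exact ⟨d.edge, List.mem_map_of_mem hd, mk_mem_cut_iff.2 ⟨d.adj, by tauto⟩⟩
  · obtain ⟨d, hd, h1, h2⟩ := P.exists_boundary_dart Xᶜ ha (by tauto)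
    refine ⟨d.edge, List.mem_map_of_mem hd, mk_mem_cut_iff.2 ⟨d.adj, ?_⟩⟩
    simp only [Set.mem_compl_iff] at h1 h2
    tauto

variable {A B : Set V} {w u v x y : V} {c : G.Walk w w}

/-- The four ends of two edges that split a cycle into odd paths are distinct, and a cut that
separates them according to colours has at least four edges. -/
lemma SplitsIntoOddPaths.nodup_and_four_le [Finite V] (hAB : IsBipartition G A B) (hc : c.IsCycle)
    (huv : G.Adj u v) (hxy : G.Adj x y) (hu : u ∈ A) (hy : y ∈ A) (hv : v ∈ B) (hx : x ∈ B)
    (h : SplitsIntoOddPaths c u v x y) :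
    [u, v, x, y].Nodup ∧ ∀ X : Set V, u ∈ X → y ∈ X → v ∉ X → x ∉ X → 4 ≤ (cut G X).ncard := by
  obtain ⟨a, b, P, a', b', Q, hP, hQ, hPo, hQo, hd, heq⟩ := h
  have hab : a ≠ b := by
    rintro rfl
    have := end_mem_iff_of_odd hAB P hPo
    tauto
  have hab' : a' ≠ b' := by
    rintro rfl
    have := end_mem_iff_of_odd hAB Q hQo
    tauto
  have ha := start_mem_of_deleteEdges_eq_sup hc hP hPo hd heq
  have hb := start_mem_of_deleteEdges_eq_sup hc hP.reverse (by simpa using hPo)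
    (by rwa [Walk.toSubgraph_reverse]) (by rwa [Walk.toSubgraph_reverse])
  have ha' := start_mem_of_deleteEdges_eq_sup hc hQ hQo hd.symm (by rw [heq, sup_comm])
  have hb' := start_mem_of_deleteEdges_eq_sup hc hQ.reverse (by simpa using hQo)
    (by rw [Walk.toSubgraph_reverse]; exact hd.symm)
    (by rw [heq, sup_comm, Walk.toSubgraph_reverse])
  have hne : ∀ {s t}, s ∈ P.support → t ∈ Q.support → s ≠ t := by
    rintro s _ hs ht rfl
    exact Set.disjoint_left.1 hd (P.mem_verts_toSubgraph.2 hs) (Q.mem_verts_toSubgraph.2 ht)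
  have n1 := hne P.start_mem_support Q.start_mem_support
  have n2 := hne P.start_mem_support Q.end_mem_support
  have n3 := hne P.end_mem_support Q.start_mem_support
  have n4 := hne P.end_mem_support Q.end_mem_support
  have hdisj := Set.disjoint_left.1 hAB.1.disjoint
  have hvA : v ∉ A := fun h => hdisj h hv
  have hxA : x ∉ A := fun h => hdisj h hx
  have nuv := huv.ne
  have nxy := hxy.ne
  have nux : u ≠ x := by rintro rfl; exact hxA hu
  have nvy : v ≠ y := by rintro rfl; exact hvA hy
  -- The four path ends are distinct and all belong to `{u, v, x, y}`, which therefore has four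
  -- elements.
  have hnd : u ≠ y ∧ v ≠ x := by
    clear heq hne
    constructor
    · rintro rfl
      grind
    · rintro rfl
      grind
  refine ⟨by simp [nuv, nux, hnd.1, hnd.2, nvy, nxy], fun X huX hyX hvX hxX => ?_⟩
  -- Among the four ends, lying in `X` means lying in `A`. The ends of an odd path have different
  -- colours, so each path crosses the cut.
  have hcol : ∀ z, (z = u ∨ z = v ∨ z = x ∨ z = y) → (z ∈ X ↔ z ∈ A) := by
    rintro z (rfl | rfl | rfl | rfl)
    exacts [iff_of_true huX hu, iff_of_false hvX hvA, iff_of_false hxX hxA, iff_of_true hyX hy]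
  have hPX : a ∈ X ↔ b ∉ X := by
    rw [hcol a ha, hcol b hb]
    exact end_mem_iff_of_odd hAB P hPo
  have hQX : a' ∈ X ↔ b' ∉ X := by
    rw [hcol a' ha', hcol b' hb']
    exact end_mem_iff_of_odd hAB Q hQo
  obtain ⟨e, heP, heX⟩ := exists_mem_edges_mem_cut P hPX
  obtain ⟨f, hfQ, hfX⟩ := exists_mem_edges_mem_cut Q hQX
  have hedge : ∀ g, g ∈ P.edges ∨ g ∈ Q.edges → g ≠ s(u, v) ∧ g ≠ s(x, y) := by
    intro g hg
    have : g ∈ ((c.toSubgraph.deleteEdges {s(u, v)}).deleteEdges {s(x, y)}).edgeSet := by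
      rw [heq, Subgraph.edgeSet_sup]
      exact hg.imp (P.mem_edges_toSubgraph).2 (Q.mem_edges_toSubgraph).2
    induction g with
    | _ p q =>
      rw [Subgraph.mem_edgeSet, Subgraph.deleteEdges_adj, Subgraph.deleteEdges_adj] at this
      exact ⟨this.1.2, this.2⟩
  have hef : e ≠ f := by
    rintro rfl
    induction e with
    | _ p q =>
      exact hne (P.fst_mem_support_of_mem_edges heP) (Q.fst_mem_support_of_mem_edges hfQ) rfl
  have hsub : ({s(u, v), s(x, y), e, f} : Set (Sym2 V)) ⊆ cut G X := by
    rintro g (rfl | rfl | rfl | rfl)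
    · exact mk_mem_cut_iff.2 ⟨huv, iff_of_true huX hvX⟩
    · exact mk_mem_cut_iff.2 ⟨hxy, iff_of_false hxX (not_not.2 hyX)⟩
    · exact heX
    · exact hfX
  refine le_trans (le_of_eq ?_) (Set.ncard_le_ncard hsub (Set.toFinite _))
  have he := hedge e (Or.inl heP)
  have hf := hedge f (Or.inr hfQ)
  have huvxy : s(u, v) ≠ s(x, y) := by
    rw [Ne, Sym2.eq_iff]
    rintro (⟨h, -⟩ | ⟨h, -⟩)
    exacts [nux h, hnd.1 h]
  rw [Set.ncard_insert_of_notMem, Set.ncard_insert_of_notMem, Set.ncard_pair hef]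
  · simp [he.2.symm, hf.2.symm]
  · simp [he.1.symm, hf.1.symm, huvxy]

end Cycle

/-! ### The expansion is cubic and bipartite; its cuts around old vertices. -/

section Expansion

variable {V W : Type*} {G : SimpleGraph V} {A B : Set V} {H : SimpleGraph W} {ι : V ↪ W}
  {u v x y : V} {u' v' x' y' : W}

namespace IsC4Expansion

lemma adj_iff (h : IsC4Expansion G A B H ι u v x y u' v' x' y') (p q : W) :
    H.Adj p q ↔
      (∃ a b, G.Adj a b ∧ s(a, b) ≠ s(u, v) ∧ s(a, b) ≠ s(x, y) ∧ p = ι a ∧ q = ι b) ∨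
      (s(p, q) = s(ι u, u') ∨ s(p, q) = s(ι v, v') ∨ s(p, q) = s(ι x, x') ∨ s(p, q) = s(ι y, y') ∨
        s(p, q) = s(u', v') ∨ s(p, q) = s(x', y') ∨ s(p, q) = s(u', x') ∨ s(p, q) = s(v', y')) := by
  rw [← mem_edgeSet, h.edges]
  refine or_congr ⟨?_, ?_⟩ (by simp only [Set.mem_insert_iff, Set.mem_singleton_iff])
  · rintro ⟨e, ⟨he, hne⟩, heq⟩
    induction e with
    | _ a b =>
      simp only [Set.mem_insert_iff, Set.mem_singleton_iff, not_or] at hne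
      rw [Sym2.map_mk] at heq
      rcases Sym2.eq_iff.1 heq with ⟨h1, h2⟩ | ⟨h1, h2⟩
      · exact ⟨a, b, he, hne.1, hne.2, h1.symm, h2.symm⟩
      · rw [Sym2.eq_swap] at hne
        exact ⟨b, a, SimpleGraph.Adj.symm he, hne.1, hne.2, h2.symm, h1.symm⟩
  · rintro ⟨a, b, hab, h1, h2, rfl, rfl⟩
    exact ⟨s(a, b), ⟨hab, by simp only [Set.mem_insert_iff, Set.mem_singleton_iff]; tauto⟩, rfl⟩

lemma apply_ne (h : IsC4Expansion G A B H ι u v x y u' v' x' y') (a : V) :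
    ι a ≠ u' ∧ ι a ≠ v' ∧ ι a ≠ x' ∧ ι a ≠ y' := by
  refine ⟨?_, ?_, ?_, ?_⟩ <;> rintro rfl
  exacts [h.new_notMem _ (by simp) ⟨a, rfl⟩, h.new_notMem _ (by simp) ⟨a, rfl⟩,
    h.new_notMem _ (by simp) ⟨a, rfl⟩, h.new_notMem _ (by simp) ⟨a, rfl⟩]

lemma new_ne (h : IsC4Expansion G A B H ι u v x y u' v' x' y') :
    u' ≠ v' ∧ u' ≠ x' ∧ u' ≠ y' ∧ v' ≠ x' ∧ v' ≠ y' ∧ x' ≠ y' := by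
  have := h.new_distinct
  simp only [List.nodup_cons, List.mem_cons, List.not_mem_nil] at this
  tauto

lemma adj_apply_apply (h : IsC4Expansion G A B H ι u v x y u' v' x' y') (a b : V) :
    H.Adj (ι a) (ι b) ↔ G.Adj a b ∧ s(a, b) ≠ s(u, v) ∧ s(a, b) ≠ s(x, y) := by
  rw [h.adj_iff]
  have ha := h.apply_ne a
  have hb := h.apply_ne b
  simp only [Sym2.eq_iff, EmbeddingLike.apply_eq_iff_eq, ha, hb, false_and, and_false, or_false]
  constructor
  · rintro ⟨c, d, h1, h2, h3, rfl, rfl⟩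
    exact ⟨h1, h2, h3⟩
  · rintro ⟨h1, h2, h3⟩
    exact ⟨a, b, h1, h2, h3, rfl, rfl⟩

lemma adj_new (h : IsC4Expansion G A B H ι u v x y u' v' x' y') (q : W) :
    (H.Adj u' q ↔ q = ι u ∨ q = v' ∨ q = x') ∧ (H.Adj v' q ↔ q = ι v ∨ q = u' ∨ q = y') ∧
      (H.Adj x' q ↔ q = ι x ∨ q = y' ∨ q = u') ∧ (H.Adj y' q ↔ q = ι y ∨ q = x' ∨ q = v') := by
  obtain ⟨n1, n2, n3, n4, n5, n6⟩ := h.new_ne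
  have hu := h.apply_ne u
  have hv := h.apply_ne v
  have hx := h.apply_ne x
  have hy := h.apply_ne y
  have key : ∀ p, (∀ a, ι a ≠ p) →
      ¬ ∃ a b, G.Adj a b ∧ s(a, b) ≠ s(u, v) ∧ s(a, b) ≠ s(x, y) ∧ p = ι a ∧ q = ι b := by
    rintro p hp ⟨a, b, -, -, -, rfl, -⟩
    exact hp a rfl
  refine ⟨?_, ?_, ?_, ?_⟩
  · rw [h.adj_iff, or_iff_right (key _ fun a => (h.apply_ne a).1)]
    simp only [Sym2.eq_iff]
    grind
  · rw [h.adj_iff, or_iff_right (key _ fun a => (h.apply_ne a).2.1)]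
    simp only [Sym2.eq_iff]
    grind
  · rw [h.adj_iff, or_iff_right (key _ fun a => (h.apply_ne a).2.2.1)]
    simp only [Sym2.eq_iff]
    grind
  · rw [h.adj_iff, or_iff_right (key _ fun a => (h.apply_ne a).2.2.2)]
    simp only [Sym2.eq_iff]
    grind

lemma cases_vertex (h : IsC4Expansion G A B H ι u v x y u' v' x' y') (p : W) :
    (∃ a, p = ι a) ∨ p = u' ∨ p = v' ∨ p = x' ∨ p = y' := by
  have : p ∈ (ι '' A ∪ {v', x'}) ∪ (ι '' B ∪ {u', y'}) := by rw [h.verts]; trivial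
  rcases this with (⟨a, -, rfl⟩ | rfl | rfl) | (⟨a, -, rfl⟩ | rfl | rfl)
  · exact Or.inl ⟨a, rfl⟩
  · tauto
  · tauto
  · exact Or.inl ⟨a, rfl⟩
  · tauto
  · tauto

lemma finite [Finite V] (h : IsC4Expansion G A B H ι u v x y u' v' x' y') : Finite W := by
  rw [← Set.finite_univ_iff, ← h.verts]
  exact Set.toFinite _

lemma isBipartition (h : IsC4Expansion G A B H ι u v x y u' v' x' y') (hAB : IsBipartition G A B) :
    IsBipartition H (ι '' A ∪ {v', x'}) (ι '' B ∪ {u', y'}) := by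
  obtain ⟨n1, n2, n3, n4, n5, n6⟩ := h.new_ne
  refine ⟨⟨?_, ?_⟩, h.verts⟩
  · rw [Set.disjoint_left]
    rintro _ (⟨a, ha, rfl⟩ | rfl | rfl) (⟨b, hb, h'⟩ | h' | h')
    · rw [ι.injective h'] at hb
      exact Set.disjoint_left.1 hAB.1.disjoint ha hb
    · exact (h.apply_ne a).1 h'
    · exact (h.apply_ne a).2.2.2 h'
    · exact (h.apply_ne b).2.1 h'
    · exact n1 h'.symm
    · exact n5 h'
    · exact (h.apply_ne b).2.2.1 h'
    · exact n2 h'.symm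
    · exact n6 h'
  · intro p q hpq
    have mA : ∀ a ∈ A, ι a ∈ ι '' A ∪ {v', x'} := fun a ha => Or.inl ⟨a, ha, rfl⟩
    have mB : ∀ a ∈ B, ι a ∈ ι '' B ∪ {u', y'} := fun a ha => Or.inl ⟨a, ha, rfl⟩
    have mv : v' ∈ ι '' A ∪ {v', x'} := Or.inr (Or.inl rfl)
    have mx : x' ∈ ι '' A ∪ {v', x'} := Or.inr (Or.inr rfl)
    have mu : u' ∈ ι '' B ∪ {u', y'} := Or.inr (Or.inl rfl)
    have my : y' ∈ ι '' B ∪ {u', y'} := Or.inr (Or.inr rfl)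
    have hu := mA u h.u_mem
    have hy := mA y h.y_mem
    have hv := mB v h.v_mem
    have hx := mB x h.x_mem
    rcases (h.adj_iff p q).1 hpq with ⟨a, b, hab, -, -, rfl, rfl⟩ | h'
    · exact (hAB.1.mem_of_adj hab).imp (fun h => ⟨mA _ h.1, mB _ h.2⟩)
        fun h => ⟨mB _ h.1, mA _ h.2⟩
    · simp only [Sym2.eq_iff] at h'
      rcases h' with (⟨rfl, rfl⟩ | ⟨rfl, rfl⟩) | (⟨rfl, rfl⟩ | ⟨rfl, rfl⟩) |
        (⟨rfl, rfl⟩ | ⟨rfl, rfl⟩) | (⟨rfl, rfl⟩ | ⟨rfl, rfl⟩) | (⟨rfl, rfl⟩ | ⟨rfl, rfl⟩) |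
        (⟨rfl, rfl⟩ | ⟨rfl, rfl⟩) | (⟨rfl, rfl⟩ | ⟨rfl, rfl⟩) | (⟨rfl, rfl⟩ | ⟨rfl, rfl⟩)
      all_goals first
        | exact Or.inl ⟨by assumption, by assumption⟩
        | exact Or.inr ⟨by assumption, by assumption⟩

lemma nodup_and_four_le [Finite V] (h : IsC4Expansion G A B H ι u v x y u' v' x' y')
    (hAB : IsBipartition G A B) :
    [u, v, x, y].Nodup ∧
      ∀ X : Set V, u ∈ X → y ∈ X → v ∉ X → x ∉ X → 4 ≤ (cut G X).ncard := by
  obtain ⟨D, w, c, hc, -, -, hs⟩ := h.common_face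
  exact hs.nodup_and_four_le hAB hc.1 h.adj_uv h.adj_xy h.u_mem h.y_mem h.v_mem h.x_mem

lemma ne [Finite V] (h : IsC4Expansion G A B H ι u v x y u' v' x' y')
    (hAB : IsBipartition G A B) :
    u ≠ v ∧ u ≠ x ∧ u ≠ y ∧ v ≠ x ∧ v ≠ y ∧ x ≠ y := by
  have := (h.nodup_and_four_le hAB).1
  simp only [List.nodup_cons, List.mem_cons, List.not_mem_nil] at this
  tauto

/-- Serves `u, v, x, y`, each of which trades one old neighbour for a new vertex. -/
lemma ncard_neighborSet_of_replace [Finite V] {a b : V} {c : W} (hab : G.Adj a b)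
    (hc : c ∉ Set.range ι) (hadj : ∀ d, H.Adj (ι a) (ι d) ↔ G.Adj a d ∧ d ≠ b)
    (hnew : ∀ z ∉ Set.range ι, H.Adj (ι a) z ↔ z = c) :
    (H.neighborSet (ι a)).ncard = (G.neighborSet a).ncard := by
  have : H.neighborSet (ι a) = insert c (ι '' (G.neighborSet a \ {b})) := by
    ext z
    rw [mem_neighborSet, Set.mem_insert_iff]
    by_cases hz : z ∈ Set.range ι
    · obtain ⟨d, rfl⟩ := hz
      have : ι d ≠ c := by rintro rfl; exact hc ⟨d, rfl⟩
      rw [hadj, or_iff_right this, ι.injective.mem_set_image]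
      rfl
    · rw [hnew z hz, or_iff_left]
      rintro ⟨d, -, rfl⟩
      exact hz ⟨d, rfl⟩
  rw [this, Set.ncard_insert_of_notMem (by rintro ⟨d, -, hd⟩; exact hc ⟨d, hd⟩) (Set.toFinite _),
    Set.ncard_image_of_injective _ ι.injective]
  exact Set.ncard_sdiff_singleton_add_one hab (Set.toFinite _)

lemma cubic [Finite V] (h : IsC4Expansion G A B H ι u v x y u' v' x' y')
    (hAB : IsBipartition G A B) (hk : ∀ a, (G.neighborSet a).ncard = 3) (p : W) :
    (H.neighborSet p).ncard = 3 := by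
  obtain ⟨n1, n2, n3, n4, n5, n6⟩ := h.new_ne
  obtain ⟨m1, m2, m3, m4, m5, m6⟩ := h.ne hAB
  have hu := h.apply_ne u
  have hv := h.apply_ne v
  have hx := h.apply_ne x
  have hy := h.apply_ne y
  have three : ∀ {a b c : W}, a ≠ b → a ≠ c → b ≠ c → ({a, b, c} : Set W).ncard = 3 :=
    fun hab hac hbc => Set.ncard_eq_three.2 ⟨_, _, _, hab, hac, hbc, rfl⟩
  rcases h.cases_vertex p with ⟨a, rfl⟩ | rfl | rfl | rfl | rfl
  · have hnew : ∀ z ∉ Set.range ι, H.Adj (ι a) z ↔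
        (a = u ∧ z = u' ∨ a = v ∧ z = v' ∨ a = x ∧ z = x' ∨ a = y ∧ z = y') := by
      intro z hz
      have ha := h.apply_ne a
      rcases h.cases_vertex z with ⟨b, rfl⟩ | rfl | rfl | rfl | rfl
      · exact absurd ⟨b, rfl⟩ hz
      · rw [H.adj_comm, (h.adj_new _).1, EmbeddingLike.apply_eq_iff_eq]; tauto
      · rw [H.adj_comm, (h.adj_new _).2.1, EmbeddingLike.apply_eq_iff_eq]; tauto
      · rw [H.adj_comm, (h.adj_new _).2.2.1, EmbeddingLike.apply_eq_iff_eq]; tauto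
      · rw [H.adj_comm, (h.adj_new _).2.2.2, EmbeddingLike.apply_eq_iff_eq]; tauto
    rw [← hk a]
    by_cases h1 : a = u
    · subst h1
      refine ncard_neighborSet_of_replace h.adj_uv (h.new_notMem u' (by simp)) (fun d => ?_)
        fun z hz => (hnew z hz).trans (by simp [m1, m2, m3])
      rw [h.adj_apply_apply, Ne, Ne, Sym2.eq_iff, Sym2.eq_iff]
      grind
    by_cases h2 : a = v
    · subst h2
      refine ncard_neighborSet_of_replace h.adj_uv.symm (h.new_notMem v' (by simp)) (fun d => ?_)
        fun z hz => (hnew z hz).trans (by simp [m1.symm, m4, m5])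
      rw [h.adj_apply_apply, Ne, Ne, Sym2.eq_iff, Sym2.eq_iff]
      grind
    by_cases h3 : a = x
    · subst h3
      refine ncard_neighborSet_of_replace h.adj_xy (h.new_notMem x' (by simp)) (fun d => ?_)
        fun z hz => (hnew z hz).trans (by simp [m2.symm, m4.symm, m6])
      rw [h.adj_apply_apply, Ne, Ne, Sym2.eq_iff, Sym2.eq_iff]
      grind
    by_cases h4 : a = y
    · subst h4
      refine ncard_neighborSet_of_replace h.adj_xy.symm (h.new_notMem y' (by simp)) (fun d => ?_)
        fun z hz => (hnew z hz).trans (by simp [m3.symm, m5.symm, m6.symm])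
      rw [h.adj_apply_apply, Ne, Ne, Sym2.eq_iff, Sym2.eq_iff]
      grind
    rw [← Set.ncard_image_of_injective _ ι.injective]
    congr 1
    ext z
    rw [mem_neighborSet]
    by_cases hz : z ∈ Set.range ι
    · obtain ⟨d, rfl⟩ := hz
      rw [ι.injective.mem_set_image, h.adj_apply_apply, mem_neighborSet, Ne, Ne, Sym2.eq_iff,
        Sym2.eq_iff]
      tauto
    · rw [hnew z hz]
      refine iff_of_false (by tauto) ?_
      rintro ⟨d, -, rfl⟩
      exact hz ⟨d, rfl⟩
  · have : H.neighborSet p = {ι u, v', x'} := Set.ext fun q => (h.adj_new q).1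
    rw [this, three hu.2.1 hu.2.2.1 n4]
  · have : H.neighborSet p = {ι v, u', y'} := Set.ext fun q => (h.adj_new q).2.1
    rw [this, three hv.1 hv.2.2.2 n3]
  · have : H.neighborSet p = {ι x, y', u'} := Set.ext fun q => (h.adj_new q).2.2.1
    rw [this, three hx.2.2.2 hx.1 n3.symm]
  · have : H.neighborSet p = {ι y, x', v'} := Set.ext fun q => (h.adj_new q).2.2.2
    rw [this, three hy.2.2.1 hy.2.1 n4.symm]

/-- The edges of the cut of the expansion around a set of old vertices. -/
lemma mem_cut_image_iff (h : IsC4Expansion G A B H ι u v x y u' v' x' y') (Z : Set V)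
    (e : Sym2 W) :
    e ∈ cut H (ι '' Z) ↔
      (∃ f ∈ cut G Z, f ≠ s(u, v) ∧ f ≠ s(x, y) ∧ e = Sym2.map ι f) ∨ u ∈ Z ∧ e = s(ι u, u') ∨
        v ∈ Z ∧ e = s(ι v, v') ∨ x ∈ Z ∧ e = s(ι x, x') ∨ y ∈ Z ∧ e = s(ι y, y') := by
  have hn : ∀ a, u' ≠ ι a ∧ v' ≠ ι a ∧ x' ≠ ι a ∧ y' ≠ ι a := fun a =>
    ⟨(h.apply_ne a).1.symm, (h.apply_ne a).2.1.symm, (h.apply_ne a).2.2.1.symm,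
      (h.apply_ne a).2.2.2.symm⟩
  constructor
  · rintro ⟨he, _, ⟨a, ha, rfl⟩, q, hq, rfl⟩
    rw [mem_edgeSet] at he
    rcases h.cases_vertex q with ⟨b, rfl⟩ | rfl | rfl | rfl | rfl
    · rw [ι.injective.mem_set_image] at hq
      rw [h.adj_apply_apply] at he
      exact Or.inl ⟨s(a, b), mk_mem_cut_iff.2 ⟨he.1, by tauto⟩, he.2.1, he.2.2, rfl⟩
    · rw [H.adj_comm, (h.adj_new _).1, EmbeddingLike.apply_eq_iff_eq] at he
      have := h.apply_ne a
      have : a = u := by tauto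
      subst this; tauto
    · rw [H.adj_comm, (h.adj_new _).2.1, EmbeddingLike.apply_eq_iff_eq] at he
      have := h.apply_ne a
      have : a = v := by tauto
      subst this; tauto
    · rw [H.adj_comm, (h.adj_new _).2.2.1, EmbeddingLike.apply_eq_iff_eq] at he
      have := h.apply_ne a
      have : a = x := by tauto
      subst this; tauto
    · rw [H.adj_comm, (h.adj_new _).2.2.2, EmbeddingLike.apply_eq_iff_eq] at he
      have := h.apply_ne a
      have : a = y := by tauto
      subst this; tauto
  · rintro (⟨f, hf, h1, h2, rfl⟩ | ⟨hZ, rfl⟩ | ⟨hZ, rfl⟩ | ⟨hZ, rfl⟩ | ⟨hZ, rfl⟩)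
    · induction f with
      | _ a b =>
        rw [mk_mem_cut_iff] at hf
        rw [Sym2.map_mk, mk_mem_cut_iff, h.adj_apply_apply, ι.injective.mem_set_image,
          ι.injective.mem_set_image]
        exact ⟨⟨hf.1, h1, h2⟩, hf.2⟩
    all_goals
      refine ⟨?_, ι _, ⟨_, hZ, rfl⟩, _, ?_, rfl⟩
      swap
      · rintro ⟨a, -, ha⟩
        have := h.apply_ne a
        tauto
      rw [mem_edgeSet, h.adj_iff]
      tauto

lemma renameEdge_map (h : IsC4Expansion G A B H ι u v x y u' v' x' y') (f : Sym2 V) :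
    renameEdge ι u v x y u' v' x' y' (Sym2.map ι f) = Sym2.map ι f := by
  induction f with
  | _ a b =>
    have ha := h.apply_ne a
    have hb := h.apply_ne b
    simp [renameEdge, ha, hb]

lemma renameEdge_new [Finite V] (h : IsC4Expansion G A B H ι u v x y u' v' x' y')
    (hAB : IsBipartition G A B) :
    renameEdge ι u v x y u' v' x' y' s(ι u, u') = Sym2.map ι s(u, v) ∧
    renameEdge ι u v x y u' v' x' y' s(ι v, v') = Sym2.map ι s(u, v) ∧
    renameEdge ι u v x y u' v' x' y' s(ι x, x') = Sym2.map ι s(x, y) ∧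
    renameEdge ι u v x y u' v' x' y' s(ι y, y') = Sym2.map ι s(x, y) := by
  obtain ⟨m1, m2, m3, m4, m5, m6⟩ := h.ne hAB
  have hu := h.apply_ne u
  have hv := h.apply_ne v
  have hx := h.apply_ne x
  have hy := h.apply_ne y
  refine ⟨?_, ?_, ?_, ?_⟩ <;> unfold renameEdge
  · rw [if_pos (Or.inl rfl)]; rfl
  · rw [if_pos (Or.inr rfl)]; rfl
  · rw [if_neg, if_pos (Or.inl rfl)]
    · rfl
    · simp [hx, m2.symm, m4.symm]
  · rw [if_neg, if_pos (Or.inr rfl)]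
    · rfl
    · simp [hy, m3.symm, m5.symm]

/-- If `uv` crosses `Z`, then `uu'` or `vv'` crosses in `H`, depending on which end lies in `Z`;
likewise for `xy`. No bound on `Z ∩ {u, v, x, y}` is needed, so cut sizes can be compared before
such a bound is known. -/
lemma map_cut_subset [Finite V] (h : IsC4Expansion G A B H ι u v x y u' v' x' y')
    (hAB : IsBipartition G A B) (Z : Set V) :
    Sym2.map ι '' cut G Z ⊆ renameEdge ι u v x y u' v' x' y' '' cut H (ι '' Z) := by
  obtain ⟨r1, r2, r3, r4⟩ := h.renameEdge_new hAB
  rintro _ ⟨f, hf, rfl⟩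
  by_cases h1 : f = s(u, v)
  · subst h1
    by_cases hu : u ∈ Z
    · exact ⟨_, (h.mem_cut_image_iff Z _).2 (Or.inr (Or.inl ⟨hu, rfl⟩)), r1⟩
    · have hv : v ∈ Z := by
        have := (mk_mem_cut_iff.1 hf).2
        tauto
      exact ⟨_, (h.mem_cut_image_iff Z _).2 (Or.inr (Or.inr (Or.inl ⟨hv, rfl⟩))), r2⟩
  by_cases h2 : f = s(x, y)
  · subst h2
    by_cases hx : x ∈ Z
    · exact ⟨_, (h.mem_cut_image_iff Z _).2 (Or.inr (Or.inr (Or.inr (Or.inl ⟨hx, rfl⟩)))), r3⟩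
    · have hy : y ∈ Z := by
        have := (mk_mem_cut_iff.1 hf).2
        tauto
      exact ⟨_, (h.mem_cut_image_iff Z _).2 (Or.inr (Or.inr (Or.inr (Or.inr ⟨hy, rfl⟩)))), r4⟩
  exact ⟨_, (h.mem_cut_image_iff Z _).2 (Or.inl ⟨f, hf, h1, h2, rfl⟩), h.renameEdge_map f⟩

lemma ncard_cut_le [Finite V] (h : IsC4Expansion G A B H ι u v x y u' v' x' y')
    (hAB : IsBipartition G A B) (Z : Set V) : (cut G Z).ncard ≤ (cut H (ι '' Z)).ncard := by
  have := h.finite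
  rw [← Set.ncard_image_of_injective (cut G Z) (Sym2.map.injective ι.injective)]
  exact (Set.ncard_le_ncard (h.map_cut_subset hAB Z) (Set.toFinite _)).trans
    (Set.ncard_image_le (Set.toFinite _))

lemma notMem_of_ncard_le_one [Finite V] (h : IsC4Expansion G A B H ι u v x y u' v' x' y')
    (hAB : IsBipartition G A B) {Z : Set V} (hZ : (({u, v, x, y} : Set V) ∩ Z).ncard ≤ 1) :
    (u ∈ Z → v ∉ Z) ∧ (u ∈ Z → x ∉ Z) ∧ (u ∈ Z → y ∉ Z) ∧ (v ∈ Z → x ∉ Z) ∧ (v ∈ Z → y ∉ Z) ∧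
      (x ∈ Z → y ∉ Z) := by
  obtain ⟨m1, m2, m3, m4, m5, m6⟩ := h.ne hAB
  rw [Set.ncard_le_one (Set.toFinite _)] at hZ
  have key : ∀ {a b : V}, a ∈ ({u, v, x, y} : Set V) → b ∈ ({u, v, x, y} : Set V) → a ≠ b →
      a ∈ Z → b ∉ Z := fun ha hb hab haZ hbZ => hab (hZ _ ⟨ha, haZ⟩ _ ⟨hb, hbZ⟩)
  exact ⟨key (by simp) (by simp) m1, key (by simp) (by simp) m2, key (by simp) (by simp) m3,
    key (by simp) (by simp) m4, key (by simp) (by simp) m5, key (by simp) (by simp) m6⟩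

lemma ncard_le_one_of_notMem {Z : Set V} (h1 : u ∈ Z → v ∉ Z) (h2 : u ∈ Z → x ∉ Z)
    (h3 : u ∈ Z → y ∉ Z) (h4 : v ∈ Z → x ∉ Z) (h5 : v ∈ Z → y ∉ Z) (h6 : x ∈ Z → y ∉ Z) :
    (({u, v, x, y} : Set V) ∩ Z).ncard ≤ 1 := by
  rw [Set.ncard_le_one (Set.Finite.inter_of_left (Set.toFinite _) Z)]
  rintro a ⟨ha, haZ⟩ b ⟨hb, hbZ⟩
  simp only [Set.mem_insert_iff, Set.mem_singleton_iff] at ha hb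
  grind

/-- The inclusion missing from `map_cut_subset` can fail only if both ends of `uv` or of `xy` lie in
`Z`: then the renamed edge does not cross in `G`. -/
lemma renameEdge_image_cut [Finite V] (h : IsC4Expansion G A B H ι u v x y u' v' x' y')
    (hAB : IsBipartition G A B) {Z : Set V} (hZ : (({u, v, x, y} : Set V) ∩ Z).ncard ≤ 1) :
    renameEdge ι u v x y u' v' x' y' '' cut H (ι '' Z) = Sym2.map ι '' cut G Z := by
  refine Set.Subset.antisymm ?_ (h.map_cut_subset hAB Z)
  obtain ⟨z1, z2, z3, z4, z5, z6⟩ := h.notMem_of_ncard_le_one hAB hZ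
  obtain ⟨r1, r2, r3, r4⟩ := h.renameEdge_new hAB
  rintro _ ⟨e, he, rfl⟩
  rcases (h.mem_cut_image_iff Z e).1 he with
    ⟨f, hf, -, -, rfl⟩ | ⟨hz, rfl⟩ | ⟨hz, rfl⟩ | ⟨hz, rfl⟩ | ⟨hz, rfl⟩
  · exact ⟨f, hf, (h.renameEdge_map f).symm⟩
  · exact ⟨_, mk_mem_cut_iff.2 ⟨h.adj_uv, by tauto⟩, r1.symm⟩
  · exact ⟨_, mk_mem_cut_iff.2 ⟨h.adj_uv, by tauto⟩, r2.symm⟩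
  · exact ⟨_, mk_mem_cut_iff.2 ⟨h.adj_xy, by tauto⟩, r3.symm⟩
  · exact ⟨_, mk_mem_cut_iff.2 ⟨h.adj_xy, by tauto⟩, r4.symm⟩

/-- Only `uu'` with `vv'`, or `xx'` with `yy'`, could collide, and both edges of such a pair cross
only if two of the four vertices lie in `Z`. The names `uv` and `xy` are free, as these edges are
absent from `H`. -/
lemma renameEdge_injOn_cut [Finite V] (h : IsC4Expansion G A B H ι u v x y u' v' x' y')
    (hAB : IsBipartition G A B) {Z : Set V} (hZ : (({u, v, x, y} : Set V) ∩ Z).ncard ≤ 1) :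
    Set.InjOn (renameEdge ι u v x y u' v' x' y') (cut H (ι '' Z)) := by
  obtain ⟨z1, z2, z3, z4, z5, z6⟩ := h.notMem_of_ncard_le_one hAB hZ
  obtain ⟨r1, r2, r3, r4⟩ := h.renameEdge_new hAB
  have hinj := Sym2.map.injective ι.injective
  intro e he e' he' heq
  rcases (h.mem_cut_image_iff Z e).1 he with
    ⟨f, -, hf1, hf2, rfl⟩ | ⟨hz, rfl⟩ | ⟨hz, rfl⟩ | ⟨hz, rfl⟩ | ⟨hz, rfl⟩ <;>
  rcases (h.mem_cut_image_iff Z e').1 he' with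
    ⟨g, -, hg1, hg2, rfl⟩ | ⟨hz', rfl⟩ | ⟨hz', rfl⟩ | ⟨hz', rfl⟩ | ⟨hz', rfl⟩ <;>
  simp only [h.renameEdge_map, r1, r2, r3, r4] at heq <;>
  first
    | with_reducible rfl
    | exact heq
    | exact absurd hz' (z1 hz)
    | exact absurd hz' (z2 hz)
    | exact absurd hz' (z3 hz)
    | exact absurd hz' (z4 hz)
    | exact absurd hz' (z5 hz)
    | exact absurd hz' (z6 hz)
    | exact absurd hz (z1 hz')
    | exact absurd hz (z2 hz')
    | exact absurd hz (z3 hz')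
    | exact absurd hz (z4 hz')
    | exact absurd hz (z5 hz')
    | exact absurd hz (z6 hz')
    | exact absurd (hinj heq) hf1
    | exact absurd (hinj heq) hf2
    | exact absurd (hinj heq).symm hg1
    | exact absurd (hinj heq).symm hg2

lemma ncard_cut_image [Finite V] (h : IsC4Expansion G A B H ι u v x y u' v' x' y')
    (hAB : IsBipartition G A B) {Z : Set V} (hZ : (({u, v, x, y} : Set V) ∩ Z).ncard ≤ 1) :
    (cut H (ι '' Z)).ncard = (cut G Z).ncard := by
  rw [← (h.renameEdge_injOn_cut hAB hZ).ncard_image, h.renameEdge_image_cut hAB hZ,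
    Set.ncard_image_of_injective _ (Sym2.map.injective ι.injective)]

end IsC4Expansion

end Expansion

/-! ### Classification of the non-trivial 3-edge cuts of the expansion. -/

section ExpansionCuts

variable {V W : Type*} {G : SimpleGraph V} {A B : Set V} {H : SimpleGraph W} {ι : V ↪ W}
  {u v x y : V} {u' v' x' y' : W}

namespace IsC4Expansion

lemma ncard_neighborSet_inter_range_le (h : IsC4Expansion G A B H ι u v x y u' v' x' y') {c : W}
    (hc : c ∉ Set.range ι) : (H.neighborSet c ∩ Set.range ι).ncard ≤ 1 := by
  have key : ∀ a : V, (∀ b, H.Adj c (ι b) → b = a) → (H.neighborSet c ∩ Set.range ι).ncard ≤ 1 := by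
    intro a ha
    rw [← Set.ncard_singleton (ι a)]
    refine Set.ncard_le_ncard ?_ (Set.toFinite _)
    rintro _ ⟨hz, b, rfl⟩
    exact congrArg ι (ha b hz)
  rcases h.cases_vertex c with ⟨a, rfl⟩ | rfl | rfl | rfl | rfl
  · exact absurd ⟨a, rfl⟩ hc
  · refine key u fun b hb => ?_
    rw [(h.adj_new _).1, EmbeddingLike.apply_eq_iff_eq] at hb
    have := h.apply_ne b
    tauto
  · refine key v fun b hb => ?_
    rw [(h.adj_new _).2.1, EmbeddingLike.apply_eq_iff_eq] at hb
    have := h.apply_ne b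
    tauto
  · refine key x fun b hb => ?_
    rw [(h.adj_new _).2.2.1, EmbeddingLike.apply_eq_iff_eq] at hb
    have := h.apply_ne b
    tauto
  · refine key y fun b hb => ?_
    rw [(h.adj_new _).2.2.2, EmbeddingLike.apply_eq_iff_eq] at hb
    have := h.apply_ne b
    tauto

/-- Rules out the set of all old vertices in `eq_singleton_of_ncard_cut`. All four connecting edges
cross; three suffice. -/
lemma three_le_ncard_cut_range [Finite V] (h : IsC4Expansion G A B H ι u v x y u' v' x' y')
    (hAB : IsBipartition G A B) : 3 ≤ (cut H (ι '' Set.univ)).ncard := by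
  have := h.finite
  obtain ⟨n1, n2, n3, n4, n5, n6⟩ := h.new_ne
  have hu := h.apply_ne u
  have hv := h.apply_ne v
  obtain ⟨m1, m2, m3, m4, m5, m6⟩ := h.ne hAB
  have hcard : ({s(ι u, u'), s(ι v, v'), s(ι x, x')} : Set (Sym2 W)).ncard = 3 := by
    refine Set.ncard_eq_three.2 ⟨_, _, _, ?_, ?_, ?_, rfl⟩ <;> simp [m1, m2, m4, hu, hv]
  rw [← hcard]
  refine Set.ncard_le_ncard ?_ (Set.toFinite _)
  rintro e (rfl | rfl | rfl) <;> rw [h.mem_cut_image_iff] <;> simp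

/-- In the expansion, a shore of a 3-edge cut with exactly one new vertex is trivial. -/
lemma eq_singleton_of_ncard_cut [Finite V] (h : IsC4Expansion G A B H ι u v x y u' v' x' y')
    (hAB : IsBipartition G A B) (hk : ∀ a, (G.neighborSet a).ncard = 3)
    (h3 : ∀ X : Set V, X.Nonempty → Xᶜ.Nonempty → 3 ≤ (cut G X).ncard) {Y : Set W} {c : W}
    (hc : c ∉ Set.range ι) (hcY : c ∈ Y) (hY : ∀ z ∈ Y, z ∉ Set.range ι → z = c)
    (hcut : (cut H Y).ncard = 3) : Y = {c} := by
  have := h.finite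
  set Z : Set V := ι ⁻¹' Y with hZ
  have hcZ : c ∉ ι '' Z := fun ⟨a, _, ha⟩ => hc ⟨a, ha⟩
  have eY : Y = ι '' Z ∪ {c} := by
    ext z
    constructor
    · intro hz
      by_cases hr : z ∈ Set.range ι
      · obtain ⟨a, rfl⟩ := hr
        exact Or.inl ⟨a, hz, rfl⟩
      · exact Or.inr (hY z hz hr)
    · rintro (⟨a, ha, rfl⟩ | rfl)
      · exact ha
      · exact hcY
  have eZ : (ι '' Z)ᶜ = Yᶜ ∪ {c} := by
    ext z
    rw [eY]
    by_cases hz : z = c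
    · subst hz
      simp [hcZ]
    · simp [hz]
  have d1 : Disjoint (ι '' Z) {c} := Set.disjoint_singleton_right.2 hcZ
  have d2 : Disjoint Yᶜ {c} := Set.disjoint_singleton_right.2 (not_not.2 hcY)
  have e1 : adjCount H {c} Set.univ = 3 := by
    rw [adjCount_univ_right (h.cubic hAB hk), Set.ncard_singleton]
  have e2 : adjCount H {c} Set.univ =
      adjCount H {c} Yᶜ + (adjCount H {c} (ι '' Z) + adjCount H {c} {c}) := by
    rw [← adjCount_union_right _ d1, ← eY, ← adjCount_union_right _ disjoint_compl_left,
      Set.compl_union_self]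
  have e3 : adjCount H {c} {c} = 0 := by
    rw [adjCount_eq_zero_iff]
    rintro a rfl b rfl
    exact H.irrefl
  have e4 : adjCount H {c} (ι '' Z) ≤ 1 := by
    refine (adjCount_mono subset_rfl (Set.image_subset_range _ _)).trans ?_
    rw [adjCount_singleton_left]
    exact h.ncard_neighborSet_inter_range_le hc
  have e5 : adjCount H Y Yᶜ = adjCount H (ι '' Z) Yᶜ + adjCount H {c} Yᶜ := by
    rw [← adjCount_union_left d1, ← eY]
  have e6 : (cut H (ι '' Z)).ncard = adjCount H (ι '' Z) Yᶜ + adjCount H (ι '' Z) {c} := by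
    rw [ncard_cut, eZ, adjCount_union_right _ d2]
  rw [ncard_cut] at hcut
  rw [adjCount_comm _ {c}] at e6
  have e7 := h.ncard_cut_le hAB Z
  rcases eq_empty_or_univ_of_ncard_cut_lt h3 (X := Z) (by omega) with hE | hE
  · rw [eY, hE]
    simp
  · have := h.three_le_ncard_cut_range hAB
    rw [hE] at e6 e4 e2 e5
    omega

/-- A vertex of `Y` in a class sending no edge out of `Y` has all its neighbours in `Y`, and both
`u'` and `y'` are adjacent to `v'` and `x'`. -/
lemma new_mem_of_adjCount_eq_zero [Finite V] (h : IsC4Expansion G A B H ι u v x y u' v' x' y')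
    {Y : Set W} (h0 : adjCount H (Y ∩ (ι '' B ∪ {u', y'})) Yᶜ = 0) :
    (u' ∈ Y → v' ∈ Y ∧ x' ∈ Y) ∧ (y' ∈ Y → v' ∈ Y ∧ x' ∈ Y) := by
  have := h.finite
  rw [adjCount_eq_zero_iff] at h0
  have key : ∀ p ∈ Y, p ∈ ι '' B ∪ {u', y'} → ∀ q, H.Adj p q → q ∈ Y := by
    intro p hp hpB q hpq
    by_contra hq
    exact h0 p ⟨hp, hpB⟩ q hq hpq
  refine ⟨fun hp => ?_, fun hp => ?_⟩
  · have := key u' hp (by simp)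
    exact ⟨this v' ((h.adj_new _).1.2 (by simp)), this x' ((h.adj_new _).1.2 (by simp))⟩
  · have := key y' hp (by simp)
    exact ⟨this v' ((h.adj_new _).2.2.2.2 (by simp)), this x' ((h.adj_new _).2.2.2.2 (by simp))⟩

lemma subset_range_iff (h : IsC4Expansion G A B H ι u v x y u' v' x' y') {Y : Set W} :
    Y ⊆ Set.range ι ↔ u' ∉ Y ∧ v' ∉ Y ∧ x' ∉ Y ∧ y' ∉ Y := by
  constructor
  · intro hY
    refine ⟨fun hz => h.new_notMem u' (by simp) (hY hz), fun hz => h.new_notMem v' (by simp) (hY hz),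
      fun hz => h.new_notMem x' (by simp) (hY hz), fun hz => h.new_notMem y' (by simp) (hY hz)⟩
  · rintro ⟨h1, h2, h3, h4⟩ p hp
    rcases h.cases_vertex p with ⟨a, rfl⟩ | rfl | rfl | rfl | rfl
    · exact ⟨a, rfl⟩
    all_goals contradiction

/-- A non-trivial 3-edge cut of the expansion does not separate the new vertices. -/
lemma subset_range_or_compl_subset_range [Finite V]
    (h : IsC4Expansion G A B H ι u v x y u' v' x' y') (hAB : IsBipartition G A B)
    (hk : ∀ a, (G.neighborSet a).ncard = 3)
    (h3 : ∀ X : Set V, X.Nonempty → Xᶜ.Nonempty → 3 ≤ (cut G X).ncard) {Y : Set W}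
    (hcut : (cut H Y).ncard = 3) (hY : Y.Nontrivial) (hY' : Yᶜ.Nontrivial) :
    Y ⊆ Set.range ι ∨ Yᶜ ⊆ Set.range ι := by
  have := h.finite
  have hAB' := h.isBipartition hAB
  have hk' := h.cubic hAB hk
  -- The claim is symmetric in the two shores. If the cut edges leave `Y` from the class of `u'` and
  -- `y'`, then they leave `Yᶜ` from the other class.
  wlog h0 : adjCount H (Y ∩ (ι '' B ∪ {u', y'})) Yᶜ = 0 generalizing Y with hw
  · have hcut' : (cut H Yᶜ).ncard = 3 := by rwa [cut_compl]
    have := @hw Yᶜ hcut' hY' (by rwa [compl_compl])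
    rw [compl_compl] at this
    refine (this ?_).symm
    rcases three_cut_sides hAB' hk' hcut with h1 | h1
    · exact absurd h1.1 h0
    · rw [adjCount_eq_zero_iff]
      rintro p ⟨hpY, hpB⟩ q hq hpq
      have hqA : q ∈ ι '' A ∪ {v', x'} := by
        rcases hAB'.1.mem_of_adj hpq with h' | h'
        · exact absurd hpB (Set.disjoint_left.1 hAB'.1.disjoint h'.1)
        · exact h'.2
      exact adjCount_eq_zero_iff.1 h1.1 q ⟨hq, hqA⟩ p hpY hpq.symm
  have hcut' : (cut H Yᶜ).ncard = 3 := by rwa [cut_compl]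
  obtain ⟨a1, a2⟩ := h.new_mem_of_adjCount_eq_zero h0
  have single : ∀ {X : Set W} {c : W}, X.Nontrivial → (cut H X).ncard = 3 → c ∉ Set.range ι →
      c ∈ X → ¬ ∀ z ∈ X, z ∉ Set.range ι → z = c := by
    intro X c hX hXcut hc hcX hz
    rw [h.eq_singleton_of_ncard_cut hAB hk h3 hc hcX hz hXcut] at hX
    exact Set.not_nontrivial_singleton hX
  have out : ∀ z, z ∉ Set.range ι → z = u' ∨ z = v' ∨ z = x' ∨ z = y' := by
    intro z hz
    rcases h.cases_vertex z with ⟨a, rfl⟩ | h'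
    · exact absurd ⟨a, rfl⟩ hz
    · exact h'
  have ru := h.new_notMem u' (by simp)
  have rv := h.new_notMem v' (by simp)
  have rx := h.new_notMem x' (by simp)
  have ry := h.new_notMem y' (by simp)
  -- If just one of `u', y'` is in `Y`, the other is the only new vertex of `Yᶜ`, which is then a
  -- singleton. If neither is, then `v'` and `x'` both in `Y` would put the whole new 4-cycle into
  -- the cut, and just one of them would make `Y` a singleton.
  by_cases hu : u' ∈ Y <;> by_cases hy : y' ∈ Y
  · exact Or.inr (h.subset_range_iff.2 ⟨not_not.2 hu, not_not.2 (a1 hu).1, not_not.2 (a1 hu).2,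
      not_not.2 hy⟩)
  · refine (single hY' hcut' ry hy fun z hz hzr => ?_).elim
    rcases out z hzr with rfl | rfl | rfl | rfl
    exacts [absurd hu hz, absurd (a1 hu).1 hz, absurd (a1 hu).2 hz, rfl]
  · refine (single hY' hcut' ru hu fun z hz hzr => ?_).elim
    rcases out z hzr with rfl | rfl | rfl | rfl
    exacts [rfl, absurd (a2 hy).1 hz, absurd (a2 hy).2 hz, absurd hy hz]
  · by_cases hv : v' ∈ Y <;> by_cases hx : x' ∈ Y
    · exfalso
      have hsub : ({s(v', u'), s(v', y'), s(x', u'), s(x', y')} : Set (Sym2 W)) ⊆ cut H Y := by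
        rintro e (rfl | rfl | rfl | rfl)
        · exact mk_mem_cut_iff.2 ⟨(h.adj_new _).2.1.2 (by simp), iff_of_true hv hu⟩
        · exact mk_mem_cut_iff.2 ⟨(h.adj_new _).2.1.2 (by simp), iff_of_true hv hy⟩
        · exact mk_mem_cut_iff.2 ⟨(h.adj_new _).2.2.1.2 (by simp), iff_of_true hx hu⟩
        · exact mk_mem_cut_iff.2 ⟨(h.adj_new _).2.2.1.2 (by simp), iff_of_true hx hy⟩
      have hle := Set.ncard_le_ncard hsub (Set.toFinite _)
      obtain ⟨n1, n2, n3, n4, n5, n6⟩ := h.new_ne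
      rw [hcut, Set.ncard_insert_of_notMem, Set.ncard_insert_of_notMem, Set.ncard_pair] at hle
      · omega
      all_goals simp only [Set.mem_insert_iff, Set.mem_singleton_iff, ne_eq, Sym2.eq_iff]
      · rintro (⟨-, h'⟩ | ⟨h', -⟩)
        exacts [n3 h', n6 h']
      · rintro ((⟨h', -⟩ | ⟨h', -⟩) | (⟨h', -⟩ | ⟨h', -⟩))
        exacts [n4 h', n1 h'.symm, n4 h', n5 h']
      · rintro ((⟨-, h'⟩ | ⟨h', -⟩) | (⟨h', -⟩ | ⟨h', -⟩) | (⟨h', -⟩ | ⟨h', -⟩))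
        exacts [n3 h', n5 h', n4 h', n1 h'.symm, n4 h', n5 h']
    · refine (single hY hcut rv hv fun z hz hzr => ?_).elim
      rcases out z hzr with rfl | rfl | rfl | rfl
      exacts [absurd hz hu, rfl, absurd hz hx, absurd hz hy]
    · refine (single hY hcut rx hx fun z hz hzr => ?_).elim
      rcases out z hzr with rfl | rfl | rfl | rfl
      exacts [absurd hz hu, absurd hz hv, rfl, absurd hz hy]
    · exact Or.inl (h.subset_range_iff.2 ⟨hu, hv, hx, hy⟩)

/-- A 3-edge cut of the expansion whose shore consists of old vertices has at most one of
`u, v, x, y` in that shore. -/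
lemma ncard_inter_le_one [Finite V] (h : IsC4Expansion G A B H ι u v x y u' v' x' y')
    (hAB : IsBipartition G A B) (hk : ∀ a, (G.neighborSet a).ncard = 3) {Z : Set V}
    (hcut : (cut H (ι '' Z)).ncard = 3) : (({u, v, x, y} : Set V) ∩ Z).ncard ≤ 1 := by
  have := h.finite
  have hfour := (h.nodup_and_four_le hAB).2
  have hle := h.ncard_cut_le hAB Z
  have n1 : ¬ (u ∈ Z ∧ y ∈ Z ∧ v ∉ Z ∧ x ∉ Z) := fun ⟨h1, h2, h3, h4⟩ => by
    have := hfour Z h1 h2 h3 h4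
    omega
  have n2 : ¬ (v ∈ Z ∧ x ∈ Z ∧ u ∉ Z ∧ y ∉ Z) := fun ⟨h1, h2, h3, h4⟩ => by
    have := hfour Zᶜ h3 h4 (not_not.2 h1) (not_not.2 h2)
    rw [cut_compl] at this
    omega
  have out : ∀ c ∉ Set.range ι, c ∈ (ι '' Z)ᶜ := fun c hc ⟨b, _, hb⟩ => hc ⟨b, hb⟩
  -- Each of `u, v, x, y` in `Z` sends a cut edge to its new neighbour, and a 3-edge cut is left
  -- from one class only.
  have hcol : (v ∉ Z ∧ x ∉ Z) ∨ (u ∉ Z ∧ y ∉ Z) := by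
    rcases three_cut_sides (h.isBipartition hAB) (h.cubic hAB hk) hcut with ⟨h0, -⟩ | ⟨h0, -⟩ <;>
      rw [adjCount_eq_zero_iff] at h0
    · refine Or.inl ⟨fun hz => ?_, fun hz => ?_⟩
      · exact h0 (ι v) ⟨⟨v, hz, rfl⟩, Or.inl ⟨v, h.v_mem, rfl⟩⟩ v'
          (out _ (h.new_notMem _ (by simp))) ((h.adj_new _).2.1.2 (Or.inl rfl)).symm
      · exact h0 (ι x) ⟨⟨x, hz, rfl⟩, Or.inl ⟨x, h.x_mem, rfl⟩⟩ x'
          (out _ (h.new_notMem _ (by simp))) ((h.adj_new _).2.2.1.2 (Or.inl rfl)).symm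
    · refine Or.inr ⟨fun hz => ?_, fun hz => ?_⟩
      · exact h0 (ι u) ⟨⟨u, hz, rfl⟩, Or.inl ⟨u, h.u_mem, rfl⟩⟩ u'
          (out _ (h.new_notMem _ (by simp))) ((h.adj_new _).1.2 (Or.inl rfl)).symm
      · exact h0 (ι y) ⟨⟨y, hz, rfl⟩, Or.inl ⟨y, h.y_mem, rfl⟩⟩ y'
          (out _ (h.new_notMem _ (by simp))) ((h.adj_new _).2.2.2.2 (Or.inl rfl)).symm
  apply ncard_le_one_of_notMem <;> tauto

lemma compl_nontrivial_of_ncard_inter_le_one [Finite V]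
    (h : IsC4Expansion G A B H ι u v x y u' v' x' y') (hAB : IsBipartition G A B) {Z : Set V}
    (hZ : (({u, v, x, y} : Set V) ∩ Z).ncard ≤ 1) : Zᶜ.Nontrivial := by
  obtain ⟨z1, z2, z3, z4, z5, z6⟩ := h.notMem_of_ncard_le_one hAB hZ
  obtain ⟨m1, m2, m3, m4, m5, m6⟩ := h.ne hAB
  by_cases hu : u ∈ Z
  · exact ⟨v, z1 hu, x, z2 hu, m4⟩
  by_cases hv : v ∈ Z
  · exact ⟨u, hu, x, z4 hv, m2⟩
  · exact ⟨u, hu, v, hv, m1⟩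

lemma image_compl_nontrivial (h : IsC4Expansion G A B H ι u v x y u' v' x' y') (Z : Set V) :
    (ι '' Z)ᶜ.Nontrivial := by
  have out : ∀ c ∉ Set.range ι, c ∈ (ι '' Z)ᶜ := fun c hc ⟨b, _, hb⟩ => hc ⟨b, hb⟩
  exact ⟨u', out _ (h.new_notMem _ (by simp)), v', out _ (h.new_notMem _ (by simp)), h.new_ne.1⟩

/-- The cuts carried over to the expansion are its non-trivial tight cuts. -/
lemma mem_expandedCuts_iff [Finite V] (h : IsC4Expansion G A B H ι u v x y u' v' x' y')
    (hAB : IsBipartition G A B) (hk : ∀ a, (G.neighborSet a).ncard = 3) (hc : G.Connected)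
    (h3 : ∀ X : Set V, X.Nonempty → Xᶜ.Nonempty → 3 ≤ (cut G X).ncard)
    {𝓕 : Set (Set (Sym2 V))} (h𝓕 : IsMaximalLaminarTightFamily G 𝓕) (D : Set (Sym2 W)) :
    D ∈ expandedCuts G H ι 𝓕 u v x y ↔ IsTightCut H D ∧ IsNontrivialCut H D := by
  have := h.finite
  have hAB' := h.isBipartition hAB
  have hk' := h.cubic hAB hk
  constructor
  · rintro ⟨X, hX, hle, rfl⟩
    rw [mem_iff_of_isMaximalLaminarTightFamily hAB hk h3 h𝓕, isTightCut_cut_iff hAB hk,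
      isNontrivialCut_cut_iff hc] at hX
    rw [isTightCut_cut_iff hAB' hk', h.ncard_cut_image hAB hle]
    exact ⟨hX.1, _, rfl, hX.2.1.image ι.injective, h.image_compl_nontrivial X⟩
  · rintro ⟨ht, Y, rfl, hY, hY'⟩
    rw [isTightCut_cut_iff hAB' hk'] at ht
    obtain ⟨Z, hZY, hZ⟩ : ∃ Z : Set V, cut H Y = cut H (ι '' Z) ∧ (ι '' Z).Nontrivial := by
      rcases h.subset_range_or_compl_subset_range hAB hk h3 ht hY hY' with hr | hr
      · obtain ⟨Z, rfl⟩ := Set.subset_range_iff_exists_image_eq.1 hr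
        exact ⟨Z, rfl, hY⟩
      · obtain ⟨Z, hZ⟩ := Set.subset_range_iff_exists_image_eq.1 hr
        exact ⟨Z, by rw [hZ, cut_compl], by rwa [hZ]⟩
    rw [hZY] at ht
    have hle := h.ncard_inter_le_one hAB hk ht
    refine ⟨Z, ?_, hle, hZY⟩
    rw [mem_iff_of_isMaximalLaminarTightFamily hAB hk h3 h𝓕, isTightCut_cut_iff hAB hk,
      isNontrivialCut_cut_iff hc, ← h.ncard_cut_image hAB hle]
    exact ⟨ht, Set.nontrivial_of_image ι Z hZ, h.compl_nontrivial_of_ncard_inter_le_one hAB hle⟩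

/-- Otherwise `X ∪ Y` would be everything, although it contains at most two of `u, v, x, y`. This
excludes the one nesting of shores that would not survive in `H`, where the new vertices lie outside
both images. -/
lemma not_compl_subset [Finite V] (h : IsC4Expansion G A B H ι u v x y u' v' x' y')
    (hAB : IsBipartition G A B) {X Y : Set V} (hX : (({u, v, x, y} : Set V) ∩ X).ncard ≤ 1)
    (hY : (({u, v, x, y} : Set V) ∩ Y).ncard ≤ 1) : ¬ Yᶜ ⊆ X := by
  intro hs
  obtain ⟨z1, z2, -, z4, -, -⟩ := h.notMem_of_ncard_le_one hAB hX
  obtain ⟨t1, t2, -, t4, -, -⟩ := h.notMem_of_ncard_le_one hAB hY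
  by_cases hu : u ∈ Y
  · exact z4 (hs (t1 hu)) (hs (t2 hu))
  · exact t4 (not_not.1 fun hv => z1 (hs hu) (hs hv)) (not_not.1 fun hx => z2 (hs hu) (hs hx))

/-- Maximality is clear, since every non-trivial tight cut of `H` is present. Laminarity is
inherited from the shores in `G`, so edge connectivity of `H` is never needed. -/
lemma isMaximalLaminarTightFamily_expandedCuts [Finite V]
    (h : IsC4Expansion G A B H ι u v x y u' v' x' y')
    (hAB : IsBipartition G A B) (hk : ∀ a, (G.neighborSet a).ncard = 3) (hc : G.Connected)
    (h3 : ∀ X : Set V, X.Nonempty → Xᶜ.Nonempty → 3 ≤ (cut G X).ncard)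
    {𝓕 : Set (Set (Sym2 V))} (h𝓕 : IsMaximalLaminarTightFamily G 𝓕) :
    IsMaximalLaminarTightFamily H (expandedCuts G H ι 𝓕 u v x y) := by
  refine ⟨⟨fun D hD => (h.mem_expandedCuts_iff hAB hk hc h3 h𝓕 D).1 hD, ?_⟩,
    fun 𝓓 h𝓓 _ D hD => (h.mem_expandedCuts_iff hAB hk hc h3 h𝓕 D).2 (h𝓓.1 D hD)⟩
  rintro _ ⟨X, hX, hXle, rfl⟩ _ ⟨Y, hY, hYle, rfl⟩ -
  replace hX := (h𝓕.prop.1 _ hX).1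
  replace hY := (h𝓕.prop.1 _ hY).1
  rw [isTightCut_cut_iff hAB hk] at hX hY
  rcases three_cuts_nested h3 hX hY with hs | hs | hs | hs
  · exact ⟨_, _, rfl, rfl, Or.inl (Set.image_mono hs)⟩
  · exact ⟨_, _, rfl, rfl, Or.inr (Set.image_mono hs)⟩
  · refine ⟨ι '' X, (ι '' Y)ᶜ, rfl, (cut_compl _).symm, Or.inl ?_⟩
    rintro _ ⟨a, ha, rfl⟩
    rw [Set.mem_compl_iff, ι.injective.mem_set_image]
    exact hs ha
  · exact absurd hs (h.not_compl_subset hAB hXle hYle)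

lemma bijOn_expandedCuts [Finite V] (h : IsC4Expansion G A B H ι u v x y u' v' x' y')
    (hAB : IsBipartition G A B) (hc : G.Connected) (𝓕 : Set (Set (Sym2 V))) :
    Set.BijOn (fun D => renameEdge ι u v x y u' v' x' y' '' D) (expandedCuts G H ι 𝓕 u v x y)
      ((fun C => Sym2.map ι '' C) '' survivingCuts G 𝓕 u v x y) := by
  obtain ⟨m1, m2, m3, m4, m5, m6⟩ := h.ne hAB
  refine ⟨?_, ?_, ?_⟩
  · rintro _ ⟨X, hX, hle, rfl⟩
    exact ⟨cut G X, ⟨hX, X, rfl, by omega⟩, (h.renameEdge_image_cut hAB hle).symm⟩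
  · rintro _ ⟨X, hX, hXle, rfl⟩ _ ⟨Y, hY, hYle, rfl⟩ heq
    simp only [h.renameEdge_image_cut hAB hXle, h.renameEdge_image_cut hAB hYle] at heq
    have heq := (Sym2.map.injective ι.injective).image_injective heq
    rcases eq_or_eq_compl_of_cut_eq hc heq with rfl | rfl
    · rfl
    · exact absurd subset_rfl (h.not_compl_subset hAB hXle hYle)
  · rintro _ ⟨C, ⟨hC, X, rfl, hne⟩, rfl⟩
    -- The two shores share the four vertices, so if neither has two of them, one has at most one
    -- and is the shore to keep.
    have hsum : (({u, v, x, y} : Set V) ∩ X).ncard + (({u, v, x, y} : Set V) ∩ Xᶜ).ncard = 4 := by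
      rw [← Set.sdiff_eq, Set.ncard_inter_add_ncard_sdiff_eq_ncard _ _ (Set.toFinite _),
        Set.ncard_insert_of_notMem, Set.ncard_insert_of_notMem, Set.ncard_pair m6]
      · simp [m4, m5]
      · simp [m1, m2, m3]
    by_cases hle : (({u, v, x, y} : Set V) ∩ X).ncard ≤ 1
    · exact ⟨_, ⟨X, hC, hle, rfl⟩, h.renameEdge_image_cut hAB hle⟩
    · have hle' : (({u, v, x, y} : Set V) ∩ Xᶜ).ncard ≤ 1 := by omega
      refine ⟨_, ⟨Xᶜ, by rwa [cut_compl], hle', rfl⟩, ?_⟩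
      simp only [h.renameEdge_image_cut hAB hle', cut_compl]

end IsC4Expansion

end ExpansionCuts

end Barnette

theorem mainTheorem5 {V W : Type*} [Fintype V] (G : SimpleGraph V)
    (hG : Barnette.IsBarnetteGraph G) (A B : Set V) (hAB : Barnette.IsBipartition G A B)
    (𝓕 : Set (Set (Sym2 V))) (h𝓕 : Barnette.IsMaximalLaminarTightFamily G 𝓕)
    (H : SimpleGraph W) (ι : V ↪ W) (u v x y : V) (u' v' x' y' : W)
    (hH : Barnette.IsC4Expansion G A B H ι u v x y u' v' x' y') :
    Barnette.IsMaximalLaminarTightFamily H (Barnette.expandedCuts G H ι 𝓕 u v x y) ∧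
      Set.BijOn (fun D => Barnette.renameEdge ι u v x y u' v' x' y' '' D)
        (Barnette.expandedCuts G H ι 𝓕 u v x y)
        ((fun C => Sym2.map ι '' C) '' Barnette.survivingCuts G 𝓕 u v x y) ∧
      ∀ D ∈ Barnette.expandedCuts G H ι 𝓕 u v x y,
        Set.InjOn (Barnette.renameEdge ι u v x y u' v' x' y') D := by
  classical
  have hk : ∀ a, (G.neighborSet a).ncard = 3 := by
    intro a
    rw [← hG.cubic a, ← SimpleGraph.card_neighborSet_eq_degree, ← Nat.card_eq_fintype_card]
    rfl
  have hc : G.Connected := hG.threeConnected.connected (by norm_num)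
  have h3 : ∀ X : Set V, X.Nonempty → Xᶜ.Nonempty → 3 ≤ (Barnette.cut G X).ncard :=
    fun X h1 h2 => Barnette.three_le_ncard_cut hk hG.threeConnected h1 h2
  refine ⟨hH.isMaximalLaminarTightFamily_expandedCuts hAB hk hc h3 h𝓕,
    hH.bijOn_expandedCuts hAB hc 𝓕, ?_⟩
  rintro _ ⟨X, -, hle, rfl⟩
  exact hH.renameEdge_injOn_cut hAB hle
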